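/- Let $\Phi$ be of type $G_2$, $F_4$, $E_6$, $E_7$ or $E_8$, with base $\Delta$ and Coxeter number $h$ ($=6,12,12,18,30$ respectively). Let $k$ be a field whose characteristic $\ell$ is $0$ or a prime. Let $\mathfrak g$ be a Lie algebra over $k$ of type $\Phi$ with a Chevalley basis: coroot vectors $H_\alpha$ ($\alpha\in\Delta$), spanning the Cartan subalgebra $\mathfrak t$, and root vectors $X_\alpha\in\mathfrak g_\alpha$ ($\alpha\in\Phi$), with $[X_\alpha,X_{-\alpha}]=H_\alpha$ and, if $\alpha+\beta$ is a root, $[X_\alpha,X_\beta]=\pm(r+1)X_{\alpha+\beta}$, where $r$ is the largest integer such that $\beta-r\alpha$ is a root. Write $2\rho^\vee=\sum_{\alpha>0}\alpha^\vee=\sum_{\alpha\in\Delta}c_\alpha\alpha^\vee$ and put $$X=\sum_{\alpha\in\Delta}X_\alpha,\qquad H=\sum_{\alpha\in\Delta}c_\alpha H_\alpha,\qquad Y=\sum_{\alpha\in\Delta}c_\alpha X_{-\alpha}.$$ Let $\varphi\colon\mathfrak{sl}_2\to\mathfrak g$ be the principal homomorphism, which sends the standard basis $e,h,f$ to $X,H,Y$;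 it makes $\mathfrak g$ an $\mathfrak{sl}_2$-module. The exponents of $\mathfrak g$ are $1,5$ for $G_2$; $1,5,7,11$ for $F_4$; $1,4,5,7,8,11$ for $E_6$; $1,5,7,9,11,13,17$ for $E_7$; $1,7,11,13,17,19,23,29$ for $E_8$. For an exponent $m$ let $P_{2m}=\{p\in\mathfrak g: [X,p]=0,\ [H,p]=2mp\}$, let $V_m$ be the $\mathfrak{sl}_2$-submodule of $\mathfrak g$ generated by $P_{2m}$, and put $L_m=V_m\cap\bigoplus_{\alpha\in\Delta}\mathfrak g_{-\alpha}$. For $\alpha\in\Delta$ let $\mathfrak l_\alpha=kH_\alpha$. (In the cases in which it is used below, $\mathfrak t=\ker\alpha\oplus\mathfrak l_\alpha$.) The list of excluded primes is - $G_2$: $\{2,3,5\}$; - $F_4$ and $E_6$: $\{2,3,5,7,11\}$; - $E_7$: $\{2,3,5,7,11,13,17,19,31,37,53\}$; - $E_8$: $\{2,3,5,7,11,13,17,19,23,29,61,67,71,97,103,109,229,269,397\}$. Then: 1. If $\ell=0$ or $\ell\ge 2h-1$, then for every exponent $m$ the submodule $V_m$ is a direct summand of the $\mathfrak{sl}_2$-module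 $\mathfrak g$, is isomorphic to $\mathrm{Sym}^{2m}(k^2)$, and is the only submodule of $\mathfrak g$ that is isomorphic to $\mathrm{Sym}^{2m}(k^2)$. 2. If $\ell=0$ or $\ell\ge h$ (in particular if $\ell$ is not in the list), then for every exponent $m$ both $P_{2m}$ and $L_m$ are one-dimensional. 3. In types $G_2,F_4,E_7,E_8$, if $\ell$ is not in the list, then for every exponent $m$ and every $\alpha\in\Delta$ the projection of the line $L_m$ to $\mathfrak g_{-\alpha}$ is nonzero. Conversely, in every type, if $\ell\ge h$ is in the list, then there are an exponent $m$ and an $\alpha\in\Delta$ for which this projection is zero. 4. In type $E_6$, suppose that $\ell$ is not in the list. If $m\ne 4,8$ is an exponent, then the projection of $L_m$ to $\mathfrak g_{-\alpha}$ is nonzero for every $\alpha\in\Delta$. There are simple roots that are not fixed by the nontrivial automorphism of the Dynkin diagram, and for every such simple root $\alpha_1$: the projections of $L_4$ and of $L_8$ to $\mathfrak g_{-\alpha_1}$ are nonzero, and for every exponent $n$ the projection of $\mathfrak t\cap V_n$ to $\mathfrak l_{\alpha_1}$ is nonzero. -/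

import Mathlib

noncomputable section

/-! ### Root systems and Chevalley bases

Throughout, `A i j = ⟨α_i, α_j^∨⟩` is a Cartan matrix.  Roots are written in the basis of simple
roots, coroots in the basis of simple coroots. -/

/-- `⟨v, α_i^∨⟩` for `v = ∑ v_j α_j`. -/
def pairSimpleCoroot {n : ℕ} (A : Matrix (Fin n) (Fin n) ℤ) (v : Fin n → ℤ) (i : Fin n) : ℤ :=
  ∑ j, v j * A j i

/-- `⟨α_i, w⟩` for `w = ∑ w_j α_j^∨`. -/
def pairSimpleRoot {n : ℕ} (A : Matrix (Fin n) (Fin n) ℤ) (i : Fin n) (w : Fin n → ℤ) : ℤ :=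
  ∑ j, A i j * w j

/-- The set of pairs `(α, α^∨)`: the smallest set that contains the pairs of a simple root and its
coroot and is stable under negation and under the simple reflections. -/
inductive IsRootPair {n : ℕ} (A : Matrix (Fin n) (Fin n) ℤ) : (Fin n → ℤ) → (Fin n → ℤ) → Prop
  | simple (i : Fin n) : IsRootPair A (Pi.single i 1) (Pi.single i 1)
  | neg {v w : Fin n → ℤ} : IsRootPair A v w → IsRootPair A (-v) (-w)
  | reflect (i : Fin n) {v w : Fin n → ℤ} : IsRootPair A v w →
      IsRootPair A (v - pairSimpleCoroot A v i • Pi.single i 1)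
        (w - pairSimpleRoot A i w • Pi.single i 1)

/-- A root, together with its coroot. -/
structure Root {n : ℕ} (A : Matrix (Fin n) (Fin n) ℤ) where
  root : Fin n → ℤ
  coroot : Fin n → ℤ
  isRootPair : IsRootPair A root coroot

/-- The simple root `α_i`. -/
def simpleRoot {n : ℕ} (A : Matrix (Fin n) (Fin n) ℤ) (i : Fin n) : Root A :=
  ⟨_, _, .simple i⟩

/-- The root `-α_i`. -/
def negSimpleRoot {n : ℕ} (A : Matrix (Fin n) (Fin n) ℤ) (i : Fin n) : Root A :=
  ⟨_, _, .neg (.simple i)⟩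

/-- The coefficient `c_i` of `α_i^∨` in the sum `2ρ^∨` of all positive coroots. -/
def twoRhoCheck {n : ℕ} (A : Matrix (Fin n) (Fin n) ℤ) (i : Fin n) : ℤ :=
  ∑ᶠ (α : Root A) (_ : 0 ≤ α.root), α.coroot i

/-- A Chevalley basis `{h_i} ∪ {x_α}` of the Lie algebra `g` over `k`, with Cartan matrix `A`:
`h_i` is the simple coroot vector, and `[x_α, x_β] = ± (r + 1) x_{α + β}` where `r` is the largest
natural number such that `β - r α` is a root. -/
structure ChevalleyBasis {n : ℕ} (A : Matrix (Fin n) (Fin n) ℤ) (k g : Type*) [Field k]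
    [LieRing g] [LieAlgebra k g] where
  basis : Module.Basis (Fin n ⊕ Root A) k g
  lie_h_h : ∀ i j, ⁅basis (.inl i), basis (.inl j)⁆ = 0
  lie_h_x : ∀ (i : Fin n) (α : Root A),
    ⁅basis (.inl i), basis (.inr α)⁆ = pairSimpleCoroot A α.root i • basis (.inr α)
  lie_x_neg : ∀ α β : Root A, α.root + β.root = 0 →
    ⁅basis (.inr α), basis (.inr β)⁆ = ∑ i, α.coroot i • basis (.inl i)
  lie_x_x : ∀ α β γ : Root A, α.root + β.root = γ.root →
    ∀ r : ℕ, IsGreatest {q : ℕ | ∃ δ : Root A, δ.root = β.root - q • α.root} r →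
      ⁅basis (.inr α), basis (.inr β)⁆ = (r + 1) • basis (.inr γ) ∨
      ⁅basis (.inr α), basis (.inr β)⁆ = -((r + 1) • basis (.inr γ))
  lie_x_x_zero : ∀ α β : Root A, α.root + β.root ≠ 0 →
    (∀ γ : Root A, γ.root ≠ α.root + β.root) → ⁅basis (.inr α), basis (.inr β)⁆ = 0

/-! ### The modules `Sym^d(k²)` of `sl₂` -/

theorem isHomogeneous_symAction {k : Type*} [Field k] {d : ℕ} (M : Matrix (Fin 2) (Fin 2) k)
    {q : MvPolynomial (Fin 2) k} (hq : q.IsHomogeneous d) :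
    (∑ i, ∑ j, MvPolynomial.C (M i j) * (MvPolynomial.X i * MvPolynomial.pderiv j q)).IsHomogeneous
      d := by
  refine MvPolynomial.IsHomogeneous.sum _ _ _ fun i _ => MvPolynomial.IsHomogeneous.sum _ _ _
    fun j _ => MvPolynomial.IsHomogeneous.C_mul ?_ _
  rcases Nat.eq_zero_or_pos d with rfl | hd
  · have h : q = MvPolynomial.C (MvPolynomial.coeff 0 q) :=
      MvPolynomial.totalDegree_eq_zero_iff_eq_C.mp
        (Nat.le_zero.mp hq.totalDegree_le)
    rw [h, MvPolynomial.pderiv_C, mul_zero]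
    exact MvPolynomial.isHomogeneous_zero _ _ _
  · have h := (MvPolynomial.isHomogeneous_X k i).mul (hq.pderiv (i := j))
    rwa [show 1 + (d - 1) = d by omega] at h

/-- The action of a `2 × 2` matrix on `Sym^d(k²)`, the space of binary forms of degree `d`, by the
derivation that extends its action `x_j ↦ ∑ M_ij x_i` on `k²`. -/
def symAction {k : Type*} [Field k] (d : ℕ) (M : Matrix (Fin 2) (Fin 2) k)
    (q : MvPolynomial.homogeneousSubmodule (Fin 2) k d) :
    MvPolynomial.homogeneousSubmodule (Fin 2) k d :=
  ⟨∑ i, ∑ j, MvPolynomial.C (M i j) *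
      (MvPolynomial.X i * MvPolynomial.pderiv j (q : MvPolynomial (Fin 2) k)),
    isHomogeneous_symAction M q.2⟩

/-- The subspace `V` of `g` is stable under `sl₂`, acting through `φ` and the adjoint action. -/
def IsSl2Stable {k g : Type*} [Field k] [LieRing g] [LieAlgebra k g]
    (φ : LieAlgebra.SpecialLinear.sl (Fin 2) k →ₗ⁅k⁆ g) (V : Submodule k g) : Prop :=
  ∀ s, ∀ v ∈ V, ⁅φ s, v⁆ ∈ V

/-- `V` is an `sl₂`-submodule of `g` that is isomorphic to `Sym^d(k²)`. -/
def IsSymPower {k g : Type*} [Field k] [LieRing g] [LieAlgebra k g]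
    (φ : LieAlgebra.SpecialLinear.sl (Fin 2) k →ₗ⁅k⁆ g) (d : ℕ) (V : Submodule k g) : Prop :=
  IsSl2Stable φ V ∧
  ∃ Φ : MvPolynomial.homogeneousSubmodule (Fin 2) k d ≃ₗ[k] V,
    ∀ (s : LieAlgebra.SpecialLinear.sl (Fin 2) k) q,
      (Φ (symAction d s.1 q) : g) = ⁅φ s, (Φ q : g)⁆

/-! ### The principal `sl₂` -/

namespace ChevalleyBasis

variable {n : ℕ} {A : Matrix (Fin n) (Fin n) ℤ} {k g : Type*} [Field k] [LieRing g]
  [LieAlgebra k g]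

/-- `X = ∑ X_α` over the simple roots `α`. -/
def principalX (B : ChevalleyBasis A k g) : g := ∑ i, B.basis (.inr (simpleRoot A i))

/-- `H = ∑ c_α H_α = 2ρ^∨`. -/
def principalH (B : ChevalleyBasis A k g) : g := ∑ i, twoRhoCheck A i • B.basis (.inl i)

/-- `Y = ∑ c_α Y_α` over the simple roots `α`. -/
def principalY (B : ChevalleyBasis A k g) : g :=
  ∑ i, twoRhoCheck A i • B.basis (.inr (negSimpleRoot A i))

/-- `φ` is the principal homomorphism: it sends the standard basis `e, h, f` of `sl₂` to
`X, H, Y`. -/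
def IsPrincipal (B : ChevalleyBasis A k g)
    (φ : LieAlgebra.SpecialLinear.sl (Fin 2) k →ₗ⁅k⁆ g) : Prop :=
  ∀ s, φ s = s.1 0 1 • B.principalX + s.1 0 0 • B.principalH + s.1 1 0 • B.principalY

/-- `P_{2m}`: the `2m`-eigenspace of `ad H` in the centralizer of `X`. -/
def centralizerEigenspace (B : ChevalleyBasis A k g) (m : ℕ) : Submodule k g where
  carrier := {p | ⁅B.principalX, p⁆ = 0 ∧ ⁅B.principalH, p⁆ = (2 * (m : k)) • p}
  add_mem' := by
    rintro a b ⟨h1, h2⟩ ⟨h3, h4⟩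
    exact ⟨by rw [lie_add, h1, h3, add_zero], by rw [lie_add, h2, h4, smul_add]⟩
  zero_mem' := ⟨lie_zero _, by rw [lie_zero, smul_zero]⟩
  smul_mem' := by
    rintro c a ⟨h1, h2⟩
    exact ⟨by rw [lie_smul, h1, smul_zero], by rw [lie_smul, h2, smul_comm]⟩

/-- `V_m`: the `sl₂`-submodule of `g` generated by `P_{2m}`. -/
def summand (B : ChevalleyBasis A k g) (φ : LieAlgebra.SpecialLinear.sl (Fin 2) k →ₗ⁅k⁆ g)
    (m : ℕ) : Submodule k g :=
  sInf {V | IsSl2Stable φ V ∧ B.centralizerEigenspace m ≤ V}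

/-- The sum of the root spaces `g_{-α}` over the simple roots `α`. -/
def negSimpleSpace (B : ChevalleyBasis A k g) : Submodule k g :=
  Submodule.span k (Set.range fun i => B.basis (.inr (negSimpleRoot A i)))

/-- The Cartan subalgebra `t`. -/
def cartanSpace (B : ChevalleyBasis A k g) : Submodule k g :=
  Submodule.span k (Set.range fun i => B.basis (.inl i))

/-- `V` has nonzero projection to the root space `g_{-α_i}`. -/
def ProjNegRootNonzero (B : ChevalleyBasis A k g) (V : Submodule k g) (i : Fin n) : Prop :=
  ∃ v ∈ V, B.basis.repr v (.inr (negSimpleRoot A i)) ≠ 0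

/-- `V ⊆ t` has nonzero projection to the line `l_α` spanned by the coroot vector of `α = α_i`, with
respect to the decomposition `t = ker α ⊕ l_α`. -/
def ProjCorootNonzero (B : ChevalleyBasis A k g) (V : Submodule k g) (i : Fin n) : Prop :=
  ∃ v ∈ V, ∃ w ∈ B.cartanSpace, ∃ c : k, ⁅w, B.basis (.inr (simpleRoot A i))⁆ = 0 ∧ c ≠ 0 ∧
    v = w + c • B.basis (.inl i)

end ChevalleyBasis

/-! ### The exceptional types -/

inductive ExceptionalType
  | G₂ | F₄ | E₆ | E₇ | E₈

namespace ExceptionalType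

def rank : ExceptionalType → ℕ
  | G₂ => 2 | F₄ => 4 | E₆ => 6 | E₇ => 7 | E₈ => 8

def cartan : (t : ExceptionalType) → Matrix (Fin t.rank) (Fin t.rank) ℤ
  | G₂ => CartanMatrix.G₂
  | F₄ => CartanMatrix.F₄
  | E₆ => CartanMatrix.E₆
  | E₇ => CartanMatrix.E₇
  | E₈ => CartanMatrix.E₈

def exponents : ExceptionalType → Finset ℕ
  | G₂ => {1, 5}
  | F₄ => {1, 5, 7, 11}
  | E₆ => {1, 4, 5, 7, 8, 11}
  | E₇ => {1, 5, 7, 9, 11, 13, 17}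
  | E₈ => {1, 7, 11, 13, 17, 19, 23, 29}

def coxeterNumber : ExceptionalType → ℕ
  | G₂ => 6 | F₄ => 12 | E₆ => 12 | E₇ => 18 | E₈ => 30

/-- The list of excluded primes. -/
def badPrimes : ExceptionalType → Finset ℕ
  | G₂ => {2, 3, 5}
  | F₄ => {2, 3, 5, 7, 11}
  | E₆ => {2, 3, 5, 7, 11}
  | E₇ => {2, 3, 5, 7, 11, 13, 17, 19, 31, 37, 53}
  | E₈ => {2, 3, 5, 7, 11, 13, 17, 19, 23, 29, 61, 67, 71, 97, 103, 109, 229, 269, 397}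

/-- The simple root `α_i` is not fixed by some automorphism of the Dynkin diagram. -/
def IsMoved (t : ExceptionalType) (i : Fin t.rank) : Prop :=
  ∃ σ : Equiv.Perm (Fin t.rank), (∀ a b, t.cartan (σ a) (σ b) = t.cartan a b) ∧ σ i ≠ i

end ExceptionalType

end

/-!
The adjoint action of `H` grades `g` by twice the height, `X` and `Y` having degrees `1` and `-1`.
On the Cartan subalgebra `ad Y ∘ ad X` is the integral matrix `N = diag(c) A`, and
`(ad Y) ^ i ∘ (ad X) ^ i` is `∏ (N - a (a + 1))` over `a < i`. The eigenvalues of `N` are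
`m (m + 1)` for the exponents `m`, and they are simple. If `ℓ = 0` or `ℓ ≥ h`, the product therefore
has rank at least the number of exponents `m ≥ i`. The number of roots of height `i` is that same
number, so `(ad X) ^ i` maps the Cartan subalgebra onto the part of degree `i`, and `(ad Y) ^ i` is
injective there.

It follows that `P_{2m}` is spanned by `(ad X) ^ m u` for an eigenvector `u` of `N` with eigenvalue
`m (m + 1)`, that `V_m` meets the Cartan subalgebra in the line through `u`, and that `L_m` is
spanned by `[Y, u]`, whose coordinates are proportional to those of `u`. Computed over `ℤ`, the
latter are integers, and the excluded primes are those less than `h` together with the prime factors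
of the nonzero ones.
-/

section Casimir

open Finset Module Module.End Polynomial

variable {k W : Type*} [Field k] [AddCommGroup W] [Module k W]

/-- The polynomial `∏ (x - a (a + 1))`; the Casimir operator `f e + (h / 2) (h / 2 + 1)` of `sl₂`
acts by `a (a + 1)` on a module with highest weight `2 a`. -/
noncomputable def casimirPoly (R : Type*) [CommRing R] (S : Finset ℕ) : R[X] :=
  ∏ a ∈ S, (X - C ((a : R) * (a + 1)))

theorem finrank_ker_mul_le [FiniteDimensional k W] (f g : End k W) :
    finrank k (LinearMap.ker (f * g)) ≤
      finrank k (LinearMap.ker f) + finrank k (LinearMap.ker g) := by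
  have hle : LinearMap.ker g ≤ LinearMap.ker (f * g) := fun x hx ↦ by
    rw [LinearMap.mem_ker, mul_apply, LinearMap.mem_ker.mp hx, map_zero]
  have hrange : LinearMap.range (g.domRestrict (LinearMap.ker (f * g))) ≤ LinearMap.ker f := by
    rintro _ ⟨⟨x, hx⟩, rfl⟩
    exact hx
  have hker : finrank k (LinearMap.ker (g.domRestrict (LinearMap.ker (f * g)))) =
      finrank k (LinearMap.ker g) := by
    rw [LinearMap.ker_domRestrict]
    exact (Submodule.comapSubtypeEquivOfLe hle).finrank_eq
  rw [← LinearMap.finrank_range_add_finrank_ker (g.domRestrict (LinearMap.ker (f * g))), hker]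
  exact add_le_add_left (Submodule.finrank_mono hrange) _

theorem finrank_ker_aeval_casimirPoly_le [FiniteDimensional k W] {N : End k W} {S : Finset ℕ}
    (hS : ∀ a ∈ S, finrank k (N.eigenspace (a * (a + 1))) ≤ 1) :
    finrank k (LinearMap.ker (aeval N (casimirPoly k S))) ≤ #S := by
  induction S using Finset.induction_on with
  | empty =>
    rw [casimirPoly, prod_empty, map_one, Module.End.one_eq_id, LinearMap.ker_id, finrank_bot,
      card_empty]
  | insert a S ha ih =>
    have hfactor : LinearMap.ker (aeval N (X - C ((a : k) * (a + 1)))) =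
        N.eigenspace (a * (a + 1)) := by
      rw [map_sub, aeval_X, aeval_C, Algebra.algebraMap_eq_smul_one, eigenspace_def]
    have hprod : casimirPoly k (insert a S) = casimirPoly k S * (X - C ((a : k) * (a + 1))) := by
      rw [casimirPoly, prod_insert ha, mul_comm, casimirPoly]
    rw [hprod, map_mul, card_insert_of_notMem ha]
    refine (finrank_ker_mul_le _ _).trans (add_le_add (ih fun b hb ↦ hS b (by simp [hb])) ?_)
    exact hfactor ▸ hS a (by simp)

theorem isCoprime_casimirPoly {S T : Finset ℕ}
    (h : ∀ a ∈ S, ∀ b ∈ T, (a : k) * (a + 1) ≠ b * (b + 1)) :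
    IsCoprime (casimirPoly k S) (casimirPoly k T) :=
  IsCoprime.prod_left fun a ha ↦ IsCoprime.prod_right fun b hb ↦
    isCoprime_X_sub_C_of_isUnit_sub (sub_ne_zero.mpr (h a ha b hb)).isUnit

/-- `N` is annihilated by `casimirPoly k E`, and for `m ∈ E` its eigenspace for `m (m + 1)` is the
line spanned by `u m`. Over a field of positive characteristic the eigenvalues `m (m + 1)` need not
be distinct, and `N` need not be diagonalizable. -/
structure HasExponents (N : End k W) (E : Finset ℕ) (u : ℕ → W) : Prop where
  finrank_eq : finrank k W = #E
  pos : ∀ m ∈ E, 0 < m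
  aeval_casimirPoly : aeval N (casimirPoly k E) = 0
  eigenspace_eq : ∀ m ∈ E, N.eigenspace (m * (m + 1)) = k ∙ u m
  casimir_ne : ∀ m ∈ E, ∀ a < m, a ∉ E → (a : k) * (a + 1) ≠ m * (m + 1)

namespace HasExponents

variable {N : End k W} {E : Finset ℕ} {u : ℕ → W}

theorem casimir_ne_zero (hN : HasExponents N E u) {m : ℕ} (hm : m ∈ E) :
    (m : k) * (m + 1) ≠ 0 := by
  simpa using (hN.casimir_ne m hm 0 (hN.pos m hm) fun h0 ↦ (hN.pos 0 h0).false).symm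

theorem apply_eigenvector (hN : HasExponents N E u) {m : ℕ} (hm : m ∈ E) :
    N (u m) = ((m : k) * (m + 1)) • u m := by
  rw [← mem_eigenspace_iff, hN.eigenspace_eq m hm]
  exact Submodule.mem_span_singleton_self _

theorem ker_aeval_casimirPoly_range_le (hN : HasExponents N E u) (i : ℕ) :
    LinearMap.ker (aeval N (casimirPoly k (range i))) ≤
      LinearMap.ker (aeval N (casimirPoly k {m ∈ E | m < i})) := by
  have hrange : casimirPoly k (range i) =
      casimirPoly k {a ∈ range i | a ∉ E} * casimirPoly k {m ∈ E | m < i} := by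
    simp only [casimirPoly, ← prod_filter_not_mul_prod_filter (range i) (· ∈ E)]
    congr 2
    grind
  have hE : casimirPoly k E =
      casimirPoly k {m ∈ E | ¬ m < i} * casimirPoly k {m ∈ E | m < i} :=
    (prod_filter_not_mul_prod_filter E (· < i) _).symm
  have hcoprime : IsCoprime (casimirPoly k {a ∈ range i | a ∉ E})
      (casimirPoly k {m ∈ E | ¬ m < i}) := by
    refine isCoprime_casimirPoly fun a ha m hm ↦ ?_
    simp only [mem_filter, mem_range, not_lt] at ha hm
    exact hN.casimir_ne m hm.1 a (ha.1.trans_le hm.2) ha.2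
  intro x hx
  refine (disjoint_ker_aeval_of_isCoprime N hcoprime).le_bot ⟨?_, ?_⟩
  · rwa [hrange, map_mul] at hx
  · have h0 := hN.aeval_casimirPoly
    rw [hE, map_mul] at h0
    exact congrArg (· x) h0

theorem card_le_finrank_range [FiniteDimensional k W] (hN : HasExponents N E u) (i : ℕ) :
    #{m ∈ E | i ≤ m} ≤
      finrank k (LinearMap.range (aeval N (casimirPoly k (range i)))) := by
  have hker : finrank k (LinearMap.ker (aeval N (casimirPoly k (range i)))) ≤ #{m ∈ E | m < i} :=
    (Submodule.finrank_mono (hN.ker_aeval_casimirPoly_range_le i)).trans <|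
      finrank_ker_aeval_casimirPoly_le fun m hm ↦
        hN.eigenspace_eq m (mem_of_mem_filter m hm) ▸ (finrank_span_le_card {u m}).trans (by simp)
  have hcard := card_filter_add_card_filter_not (s := E) (· < i)
  simp only [not_lt] at hcard
  have := LinearMap.finrank_range_add_finrank_ker (aeval N (casimirPoly k (range i)))
  have := hN.finrank_eq
  omega

end HasExponents

end Casimir

section GradedModule

open Finset Module Module.End Polynomial LieModule

variable {k L M W : Type*} [Field k] [LieRing L] [AddCommGroup M] [Module k M]
  [LieRingModule L M] [AddCommGroup W] [Module k W] {G : ℤ → Submodule k M} {h e f : L}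

/-- A grading `M = ⨁ G j` of a module over an `sl₂`-triple `(h, e, f)`, in which `e` has degree `1`,
`f` has degree `-1`, and `h` acts on `G j` by `2 j`. In characteristic `p` the `G j` are in general
smaller than the eigenspaces of `h`. -/
structure IsSl2Grading (G : ℤ → Submodule k M) (h e f : L) : Prop extends IsSl2Triple h e f where
  iSupIndep : iSupIndep G
  iSup_eq_top : ⨆ j, G j = ⊤
  lie_h : ∀ {j v}, v ∈ G j → ⁅h, v⁆ = (2 * j : k) • v
  lie_e_mem : ∀ {j v}, v ∈ G j → ⁅e, v⁆ ∈ G (j + 1)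
  lie_f_mem : ∀ {j v}, v ∈ G j → ⁅f, v⁆ ∈ G (j - 1)

theorem toEnd_pow_succ_apply [LieAlgebra k L] [LieModule k L M] (x : L) (i : ℕ) (v : M) :
    (toEnd k L M x ^ (i + 1)) v = ⁅x, (toEnd k L M x ^ i) v⁆ := by
  rw [pow_succ', mul_apply, toEnd_apply_apply]

namespace IsSl2Grading

theorem symm (hG : IsSl2Grading G h e f) : IsSl2Grading (fun j ↦ G (-j)) (-h) f e where
  toIsSl2Triple := hG.toIsSl2Triple.symm
  iSupIndep := hG.iSupIndep.comp neg_injective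
  iSup_eq_top := ((Equiv.neg ℤ).iSup_comp (g := G)).trans hG.iSup_eq_top
  lie_h hv := by
    rw [neg_lie, hG.lie_h hv, ← neg_smul]
    push_cast
    ring_nf
  lie_e_mem {j _} hv := by simpa only [neg_add', sub_eq_add_neg] using hG.lie_f_mem hv
  lie_f_mem {j _} hv := by simpa only [neg_sub', sub_neg_eq_add] using hG.lie_e_mem hv

theorem lie_e_lie_f (hG : IsSl2Grading G h e f) {j : ℤ} {v : M} (hv : v ∈ G j) :
    ⁅e, ⁅f, v⁆⁆ = ⁅f, ⁅e, v⁆⁆ + (2 * j : k) • v := by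
  rw [leibniz_lie, hG.lie_e_f, hG.lie_h hv, add_comm]

/-- In characteristic `p` the weight `2 j` of `h` only determines the degree modulo `p`, so the
absence of vectors of negative degree killed by `e` is needed to pin down the degree. -/
theorem mem_of_lie_e_eq_zero (hG : IsSl2Grading G h e f) {m : ℕ} {v : M} (hev : ⁅e, v⁆ = 0)
    (hhv : ⁅h, v⁆ = (2 * m : k) • v)
    (hneg : ∀ j < 0, ∀ w ∈ G j, ⁅e, w⁆ = 0 → w = 0)
    (hpos : ∀ i : ℕ, i ≠ m → (2 * i : k) = 2 * m → G i = ⊥) : v ∈ G m := by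
  obtain ⟨w, hw, rfl⟩ := (Submodule.mem_iSup_iff_exists_finsupp G v).mp
    (hG.iSup_eq_top ▸ Submodule.mem_top)
  have hindep := (iSupIndep_iff_finsetSum_eq_zero_imp_eq_zero G).mp hG.iSupIndep
  have hindep' := (iSupIndep_iff_finsetSum_eq_zero_imp_eq_zero fun j ↦ G (j + 1)).mp
    (hG.iSupIndep.comp (add_left_injective 1))
  rw [Finsupp.sum] at hev hhv
  rw [lie_sum] at hev hhv
  rw [smul_sum, ← sub_eq_zero, ← sum_sub_distrib] at hhv
  refine sum_mem fun j hj ↦ ?_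
  have hej : ⁅e, w j⁆ = 0 := hindep' _ _ (fun j _ ↦ hG.lie_e_mem (hw j)) hev j hj
  have hhj : ⁅h, w j⁆ - (2 * m : k) • w j = 0 :=
    hindep _ _ (fun j _ ↦ sub_mem (hG.lie_h (hw j) ▸ Submodule.smul_mem _ _ (hw j))
      (Submodule.smul_mem _ _ (hw j))) hhv j hj
  rw [hG.lie_h (hw j), ← sub_smul, smul_eq_zero, sub_eq_zero] at hhj
  have hne : w j ≠ 0 := Finsupp.mem_support_iff.mp hj
  obtain ⟨i, rfl⟩ := Int.eq_ofNat_of_zero_le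
    (not_lt.mp fun hj0 ↦ hne (hneg j hj0 _ (hw j) hej))
  by_cases him : i = m
  · exact him ▸ hw i
  · have hbot := hpos i him (by simpa using hhj.resolve_right hne)
    exact absurd ((Submodule.mem_bot k).mp (hbot ▸ hw i)) hne

variable [LieAlgebra k L] [LieModule k L M]

theorem toEnd_e_pow_mem (hG : IsSl2Grading G h e f) {j : ℤ} {v : M} (hv : v ∈ G j) (i : ℕ) :
    (toEnd k L M e ^ i) v ∈ G (j + i) := by
  induction i with
  | zero => simpa using hv
  | succ i ih =>
    rw [toEnd_pow_succ_apply, Nat.cast_succ, ← add_assoc]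
    exact hG.lie_e_mem ih

theorem toEnd_f_pow_mem (hG : IsSl2Grading G h e f) {j : ℤ} {v : M} (hv : v ∈ G j) (i : ℕ) :
    (toEnd k L M f ^ i) v ∈ G (j - i) := by
  have hmem := hG.symm.toEnd_e_pow_mem (j := -j) (v := v) (by rwa [neg_neg]) i
  rwa [neg_add', neg_neg] at hmem

theorem lie_f_toEnd_e_pow_succ (hG : IsSl2Grading G h e f) {v : M} (hv : v ∈ G 0) (i : ℕ) :
    ⁅f, (toEnd k L M e ^ (i + 1)) v⁆ =
      (toEnd k L M e ^ i) ⁅f, ⁅e, v⁆⁆ - ((i : k) * (i + 1)) • (toEnd k L M e ^ i) v := by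
  induction i with
  | zero => simp
  | succ i ih =>
    have hcomm := hG.lie_e_lie_f (hG.toEnd_e_pow_mem hv (i + 1))
    rw [ih, lie_sub, lie_smul, ← toEnd_pow_succ_apply, ← toEnd_pow_succ_apply,
      ← toEnd_pow_succ_apply] at hcomm
    rw [eq_sub_iff_add_eq.mpr hcomm.symm, sub_sub, ← add_smul]
    push_cast
    ring_nf

theorem eq_top_of_le (hG : IsSl2Grading G h e f) {V : Submodule k M}
    (he : ∀ v ∈ V, ⁅e, v⁆ ∈ V) (hf : ∀ v ∈ V, ⁅f, v⁆ ∈ V) (h0 : G 0 ≤ V)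
    (hmape : ∀ i : ℕ, (G i).map (toEnd k L M e) = G (i + 1))
    (hmapf : ∀ i : ℕ, (G (-i)).map (toEnd k L M f) = G (-(i + 1))) : V = ⊤ := by
  have hpos : ∀ i : ℕ, G i ≤ V := fun i ↦ by
    induction i with
    | zero => exact h0
    | succ i ih =>
      rw [Nat.cast_succ, ← hmape, Submodule.map_le_iff_le_comap]
      exact fun v hv ↦ he v (ih hv)
  have hneg : ∀ i : ℕ, G (-i) ≤ V := fun i ↦ by
    induction i with
    | zero => exact h0
    | succ i ih =>
      rw [Nat.cast_succ, ← hmapf, Submodule.map_le_iff_le_comap]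
      exact fun v hv ↦ hf v (ih hv)
  rw [← top_le_iff, ← hG.iSup_eq_top, iSup_le_iff]
  intro j
  obtain ⟨i, rfl | rfl⟩ := j.eq_nat_or_neg
  exacts [hpos i, hneg i]

end IsSl2Grading

/-- A grading whose part of degree zero is identified, through `ι`, with a space `W` on which `f e`
acts by `N`, and whose other parts are no larger than the eigenvalues of `N` predict. The principal
`sl₂` of a simple Lie algebra gives the example, with `W` the Cartan subalgebra. -/
structure IsPrincipalGrading (G : ℤ → Submodule k M) (h e f : L) (ι : W →ₗ[k] M) (N : End k W)
    (E : Finset ℕ) (u : ℕ → W) : Prop extends IsSl2Grading G h e f, HasExponents N E u where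
  injective : Function.Injective ι
  range_eq : LinearMap.range ι = G 0
  lie_f_lie_e : ∀ w, ⁅f, ⁅e, ι w⁆⁆ = ι (N w)
  finrank_le : ∀ j, finrank k (G j) ≤ #{m ∈ E | j.natAbs ≤ m}

namespace IsPrincipalGrading

variable {ι : W →ₗ[k] M} {N : End k W} {E : Finset ℕ} {u : ℕ → W}

theorem mem_zero (hG : IsPrincipalGrading G h e f ι N E u) (w : W) : ι w ∈ G 0 :=
  hG.range_eq ▸ LinearMap.mem_range_self ι w

theorem lie_e_lie_f_apply (hG : IsPrincipalGrading G h e f ι N E u) (w : W) :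
    ⁅e, ⁅f, ι w⁆⁆ = ι (N w) := by
  simpa [hG.lie_f_lie_e] using hG.lie_e_lie_f (hG.mem_zero w)

theorem symm (hG : IsPrincipalGrading G h e f ι N E u) :
    IsPrincipalGrading (fun j ↦ G (-j)) (-h) f e ι N E u where
  toIsSl2Grading := hG.toIsSl2Grading.symm
  toHasExponents := hG.toHasExponents
  injective := hG.injective
  range_eq := by simpa using hG.range_eq
  lie_f_lie_e := hG.lie_e_lie_f_apply
  finrank_le j := by simpa using hG.finrank_le (-j)

theorem eq_bot_of_forall_lt (hG : IsPrincipalGrading G h e f ι N E u) [FiniteDimensional k M]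
    {j : ℤ} (hj : ∀ m ∈ E, m < j.natAbs) : G j = ⊥ := by
  have hcard := hG.finrank_le j
  rw [filter_false_of_mem fun m hm ↦ not_le.mpr (hj m hm), card_empty] at hcard
  exact Submodule.finrank_eq_zero.mp (Nat.le_zero.mp hcard)

variable [LieAlgebra k L] [LieModule k L M]

theorem toEnd_f_pow_toEnd_e_pow (hG : IsPrincipalGrading G h e f ι N E u) (i : ℕ) (w : W) :
    (toEnd k L M f ^ i) ((toEnd k L M e ^ i) (ι w)) =
      ι (aeval N (casimirPoly k (range i)) w) := by
  induction i generalizing w with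
  | zero => simp [casimirPoly]
  | succ i ih =>
    rw [pow_succ, mul_apply, toEnd_apply_apply, hG.lie_f_toEnd_e_pow_succ (hG.mem_zero w), map_sub,
      map_smul, hG.lie_f_lie_e, ih, ih, ← map_smul, ← map_sub, casimirPoly, casimirPoly,
      prod_range_succ, map_mul, mul_apply]
    simp only [map_sub, map_smul, aeval_X, aeval_C, LinearMap.sub_apply, algebraMap_end_apply]

theorem map_toEnd_f_pow_map_toEnd_e_pow (hG : IsPrincipalGrading G h e f ι N E u) (i : ℕ) :
    ((G 0).map (toEnd k L M e ^ i)).map (toEnd k L M f ^ i) =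
      (LinearMap.range (aeval N (casimirPoly k (range i)))).map ι := by
  rw [← hG.range_eq, ← LinearMap.range_comp, ← LinearMap.range_comp, ← LinearMap.range_comp]
  congr 1
  ext w
  exact hG.toEnd_f_pow_toEnd_e_pow i w

theorem card_le_finrank_map [FiniteDimensional k W] (hG : IsPrincipalGrading G h e f ι N E u)
    (i : ℕ) :
    #{m ∈ E | i ≤ m} ≤
      finrank k (((G 0).map (toEnd k L M e ^ i)).map (toEnd k L M f ^ i)) := by
  rw [hG.map_toEnd_f_pow_map_toEnd_e_pow,
    ← (Submodule.equivMapOfInjective ι hG.injective _).finrank_eq]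
  exact hG.card_le_finrank_range i

variable [FiniteDimensional k M] [FiniteDimensional k W]

theorem map_toEnd_e_pow (hG : IsPrincipalGrading G h e f ι N E u) (i : ℕ) :
    (G 0).map (toEnd k L M e ^ i) = G i := by
  refine Submodule.eq_of_le_of_finrank_le ?_ ?_
  · rw [Submodule.map_le_iff_le_comap]
    exact fun v hv ↦ by simpa using hG.toEnd_e_pow_mem hv i
  · calc finrank k (G i) ≤ #{m ∈ E | i ≤ m} := by simpa using hG.finrank_le i
      _ ≤ _ := hG.card_le_finrank_map i
      _ ≤ _ := Submodule.finrank_map_le _ _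

theorem finrank_degree (hG : IsPrincipalGrading G h e f ι N E u) (i : ℕ) :
    finrank k (G i) = #{m ∈ E | i ≤ m} := by
  refine le_antisymm (by simpa using hG.finrank_le i) ((hG.card_le_finrank_map i).trans ?_)
  rw [hG.map_toEnd_e_pow]
  exact Submodule.finrank_map_le _ _

theorem eq_zero_of_toEnd_f_pow_eq_zero (hG : IsPrincipalGrading G h e f ι N E u) {i : ℕ} {v : M}
    (hv : v ∈ G i) (hfv : (toEnd k L M f ^ i) v = 0) : v = 0 := by
  have hrank := LinearMap.finrank_range_add_finrank_ker ((toEnd k L M f ^ i).domRestrict (G i))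
  have hcard := hG.card_le_finrank_map i
  rw [hG.map_toEnd_e_pow, ← LinearMap.range_domRestrict] at hcard
  rw [hG.finrank_degree] at hrank
  have hker : LinearMap.ker ((toEnd k L M f ^ i).domRestrict (G i)) = ⊥ :=
    Submodule.finrank_eq_zero.mp (by omega)
  have hmem : (⟨v, hv⟩ : G i) ∈ LinearMap.ker ((toEnd k L M f ^ i).domRestrict (G i)) := hfv
  rw [hker, Submodule.mem_bot] at hmem
  exact congrArg Subtype.val hmem

theorem eq_zero_of_lie_f_eq_zero (hG : IsPrincipalGrading G h e f ι N E u) {j : ℤ} (hj : 0 < j)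
    {v : M} (hv : v ∈ G j) (hfv : ⁅f, v⁆ = 0) : v = 0 := by
  obtain ⟨i, rfl⟩ := Int.eq_succ_of_zero_lt hj
  refine hG.eq_zero_of_toEnd_f_pow_eq_zero (i := i + 1) hv ?_
  rw [pow_succ, mul_apply, toEnd_apply_apply, hfv, map_zero]

theorem eq_zero_of_lie_e_eq_zero (hG : IsPrincipalGrading G h e f ι N E u) {j : ℤ} (hj : j < 0)
    {v : M} (hv : v ∈ G j) (hev : ⁅e, v⁆ = 0) : v = 0 :=
  hG.symm.eq_zero_of_lie_f_eq_zero (neg_pos.mpr hj) (by rwa [neg_neg]) hev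

theorem map_toEnd_e (hG : IsPrincipalGrading G h e f ι N E u) (i : ℕ) :
    (G i).map (toEnd k L M e) = G (i + 1) := by
  have hsucc := hG.map_toEnd_e_pow (i + 1)
  rwa [pow_succ', mul_eq_comp, Submodule.map_comp, hG.map_toEnd_e_pow, Nat.cast_succ] at hsucc

theorem map_toEnd_f (hG : IsPrincipalGrading G h e f ι N E u) (i : ℕ) :
    (G (-i)).map (toEnd k L M f) = G (-(i + 1)) :=
  hG.symm.map_toEnd_e i

theorem eq_top_of_le (hG : IsPrincipalGrading G h e f ι N E u) {V : Submodule k M}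
    (he : ∀ v ∈ V, ⁅e, v⁆ ∈ V) (hf : ∀ v ∈ V, ⁅f, v⁆ ∈ V) (h0 : G 0 ≤ V) : V = ⊤ :=
  hG.toIsSl2Grading.eq_top_of_le he hf h0 hG.map_toEnd_e hG.map_toEnd_f

theorem finrank_ker_toEnd_e_inf (hG : IsPrincipalGrading G h e f ι N E u) {m : ℕ} (hm : m ∈ E) :
    finrank k ↥(LinearMap.ker (toEnd k L M e) ⊓ G m) = 1 := by
  have hrank := LinearMap.finrank_range_add_finrank_ker ((toEnd k L M e).domRestrict (G m))
  have hker : finrank k (LinearMap.ker ((toEnd k L M e).domRestrict (G m))) =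
      finrank k ↥(LinearMap.ker (toEnd k L M e) ⊓ G m) := by
    rw [LinearMap.ker_domRestrict, inf_comm, ← Submodule.map_comap_subtype,
      Submodule.finrank_map_subtype_eq]
  have hcard : #{a ∈ E | m ≤ a} = #{a ∈ E | m + 1 ≤ a} + 1 := by
    rw [← card_insert_of_notMem (s := {a ∈ E | m + 1 ≤ a}) (a := m) (by simp)]
    congr 1
    grind
  have hdeg := hG.finrank_degree (m + 1)
  rw [LinearMap.range_domRestrict, hG.map_toEnd_e, hG.finrank_degree, hker, hcard] at hrank
  push_cast at hdeg
  omega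

/-- The hypothesis `hinj` expresses that the characteristic is zero or larger than all exponents. -/
theorem mem_of_lie_e_eq_zero (hG : IsPrincipalGrading G h e f ι N E u)
    (hinj : ∀ m ∈ E, Set.InjOn (Nat.cast : ℕ → k) (Set.Iic m)) (h2 : (2 : k) ≠ 0)
    {m : ℕ} (hm : m ∈ E) {v : M} (hev : ⁅e, v⁆ = 0) (hhv : ⁅h, v⁆ = (2 * m : k) • v) :
    v ∈ G m := by
  refine hG.toIsSl2Grading.mem_of_lie_e_eq_zero hev hhv
    (fun j hj w hw hew ↦ hG.eq_zero_of_lie_e_eq_zero hj hw hew) fun i him hcast ↦ ?_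
  refine hG.eq_bot_of_forall_lt fun a ha ↦ ?_
  by_contra hai
  have hai : i ≤ a := not_lt.mp hai
  have hcast : (i : k) = m := mul_left_cancel₀ h2 hcast
  obtain h | h := le_total a m
  exacts [him (hinj m hm (hai.trans h) Set.self_mem_Iic hcast), him (hinj a ha hai h hcast)]

end IsPrincipalGrading

end GradedModule

section PrimitiveVector

open Module Module.End LieModule

variable (k : Type*) {L M : Type*} [Field k] [LieRing L] [LieAlgebra k L] [AddCommGroup M]
  [Module k M] [LieRingModule L M] [LieModule k L M]

/-- The span of the vectors `f ^ i p`. For `p` primitive with respect to an `sl₂`-triple `(h, e, f)`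
this is the `sl₂`-submodule generated by `p`. -/
def lowerSpan (f : L) (p : M) : Submodule k M :=
  Submodule.span k (Set.range fun i : ℕ ↦ (toEnd k L M f ^ i) p)

variable {k} {h e f : L} {p : M} {μ : k}

theorem mem_lowerSpan_self (f : L) (p : M) : p ∈ lowerSpan k f p :=
  Submodule.subset_span ⟨0, rfl⟩

theorem lie_f_mem_lowerSpan {v : M} (hv : v ∈ lowerSpan k f p) : ⁅f, v⁆ ∈ lowerSpan k f p := by
  rw [← toEnd_apply_apply k L M, ← Submodule.mem_comap]
  refine Submodule.span_le.mpr ?_ hv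
  rintro _ ⟨i, rfl⟩
  exact Submodule.subset_span ⟨i + 1, toEnd_pow_succ_apply f i p⟩

theorem lowerSpan_le {V : Submodule k M} (hp : p ∈ V) (hf : ∀ v ∈ V, ⁅f, v⁆ ∈ V) :
    lowerSpan k f p ≤ V := by
  rw [lowerSpan, Submodule.span_le, Set.range_subset_iff]
  intro i
  induction i with
  | zero => exact hp
  | succ i ih =>
    rw [toEnd_pow_succ_apply]
    exact hf _ ih

theorem lie_h_mem_lowerSpan {t : IsSl2Triple h e f} (P : t.HasPrimitiveVectorWith p μ) {v : M}
    (hv : v ∈ lowerSpan k f p) : ⁅h, v⁆ ∈ lowerSpan k f p := by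
  rw [← toEnd_apply_apply k L M, ← Submodule.mem_comap]
  refine Submodule.span_le.mpr ?_ hv
  rintro _ ⟨i, rfl⟩
  rw [SetLike.mem_coe, Submodule.mem_comap, toEnd_apply_apply, P.lie_h_pow_toEnd_f]
  exact Submodule.smul_mem _ _ (Submodule.subset_span ⟨i, rfl⟩)

theorem lie_e_mem_lowerSpan {t : IsSl2Triple h e f} (P : t.HasPrimitiveVectorWith p μ) {v : M}
    (hv : v ∈ lowerSpan k f p) : ⁅e, v⁆ ∈ lowerSpan k f p := by
  rw [← toEnd_apply_apply k L M, ← Submodule.mem_comap]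
  refine Submodule.span_le.mpr ?_ hv
  rintro _ ⟨i, rfl⟩
  rw [SetLike.mem_coe, Submodule.mem_comap, toEnd_apply_apply]
  cases i with
  | zero => simp [P.lie_e]
  | succ i =>
    rw [P.lie_e_pow_succ_toEnd_f]
    exact Submodule.smul_mem _ _ (Submodule.subset_span ⟨i, rfl⟩)

theorem toEnd_f_pow_ne_zero {t : IsSl2Triple h e f} {d : ℕ}
    (P : t.HasPrimitiveVectorWith p (d : k)) (hd : (d.factorial : k) ≠ 0) {i : ℕ} (hi : i ≤ d) :
    (toEnd k L M f ^ i) p ≠ 0 := by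
  have hcast : ∀ {j : ℕ}, 0 < j → j ≤ d → (j : k) ≠ 0 := fun hj hjd h0 ↦ hd <| by
    obtain ⟨c, hc⟩ := Nat.dvd_factorial hj hjd
    rw [hc, Nat.cast_mul, h0, zero_mul]
  induction i with
  | zero => exact P.ne_zero
  | succ i ih =>
    intro h0
    have hlie := P.lie_e_pow_succ_toEnd_f i
    rw [h0, lie_zero, eq_comm, smul_eq_zero, or_iff_left (ih (by omega)),
      ← Nat.cast_sub (by omega), ← Nat.cast_succ] at hlie
    exact mul_ne_zero (hcast i.succ_pos hi) (hcast (by omega) (by omega)) hlie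

/-- The Casimir operator `4 f e + h² + 2 h`. -/
def casimirEnd (k : Type*) {L : Type*} (M : Type*) [Field k] [LieRing L] [LieAlgebra k L]
    [AddCommGroup M] [Module k M] [LieRingModule L M] [LieModule k L M] (h e f : L) : End k M :=
  4 * (toEnd k L M f * toEnd k L M e) + toEnd k L M h ^ 2 + 2 * toEnd k L M h

theorem commute_casimirEnd (t : IsSl2Triple h e f) :
    Commute (casimirEnd k M h e f) (toEnd k L M f) := by
  set E := toEnd k L M e
  set F := toEnd k L M f
  set H := toEnd k L M h
  have hef : E * F = F * E + H := LinearMap.ext fun v ↦ by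
    simp [E, F, H, leibniz_lie e f v, t.lie_e_f, add_comm]
  have hhf : H * F + 2 * F = F * H := LinearMap.ext fun v ↦ by
    simp [F, H, leibniz_lie h f v, t.lie_h_f_nsmul, neg_add_eq_sub]
  calc (4 * (F * E) + H ^ 2 + 2 * H) * F
      = 4 * F * (E * F) + H * (H * F + 2 * F) := by noncomm_ring
    _ = 4 * F * (F * E + H) + H * (F * H) := by rw [hef, hhf]
    _ = 4 * F * (F * E + H) + (H * F + 2 * F) * H - 2 * F * H := by noncomm_ring
    _ = F * (4 * (F * E) + H ^ 2 + 2 * H) := by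
        rw [hhf]
        noncomm_ring

theorem lowerSpan_le_eigenspace {t : IsSl2Triple h e f} (P : t.HasPrimitiveVectorWith p μ) :
    lowerSpan k f p ≤ (casimirEnd k M h e f).eigenspace (μ * (μ + 2)) := by
  refine lowerSpan_le ?_ fun v hv ↦ ?_
  · rw [mem_eigenspace_iff]
    simp only [casimirEnd, LinearMap.add_apply, mul_apply, toEnd_apply_apply, P.lie_e,
      map_zero, sq, P.lie_h, lie_smul, zero_add, ofNat_apply]
    module
  · rw [mem_eigenspace_iff] at hv ⊢
    rw [← toEnd_apply_apply k L M, ← mul_apply, (commute_casimirEnd t).eq, mul_apply, hv, map_smul]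

end PrimitiveVector

section PrimitiveInGrading

open Module Module.End LieModule

variable {k L M W : Type*} [Field k] [LieRing L] [LieAlgebra k L] [AddCommGroup M] [Module k M]
  [LieRingModule L M] [LieModule k L M] [AddCommGroup W] [Module k W] {G : ℤ → Submodule k M}
  {h e f : L} {p : M}

theorem iSup_inf_eq_of_le {ι : Type*} {A G : ι → Submodule k M} (hG : iSupIndep G) (hA : A ≤ G)
    (j : ι) : (⨆ i, A i) ⊓ G j = A j := by
  have hbot : (⨆ i, ⨆ _ : i ≠ j, A i) ⊓ G j = ⊥ :=
    ((hG j).symm.mono_left (iSup₂_mono fun i _ ↦ hA i)).eq_bot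
  rw [iSup_split_single A j, sup_inf_assoc_of_le _ (hA j), hbot, sup_bot_eq]

namespace IsSl2Grading

theorem lowerSpan_inf (hG : IsSl2Grading G h e f) {j : ℤ} (hp : p ∈ G j) (i : ℕ) :
    lowerSpan k f p ⊓ G (j - i) = k ∙ (toEnd k L M f ^ i) p := by
  rw [lowerSpan, Submodule.span_range_eq_iSup]
  refine iSup_inf_eq_of_le (G := fun i : ℕ ↦ G (j - i))
    (hG.iSupIndep.comp fun a b hab ↦ by simpa using hab) (fun i ↦ ?_) i
  rw [Submodule.span_singleton_le_iff_mem]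
  exact hG.toEnd_f_pow_mem hp i

theorem linearIndepOn_toEnd_f_pow (hG : IsSl2Grading G h e f) {j : ℤ} (hp : p ∈ G j)
    {s : Set ℕ} (hs : ∀ i ∈ s, (toEnd k L M f ^ i) p ≠ 0) :
    LinearIndepOn k (fun i : ℕ ↦ (toEnd k L M f ^ i) p) s :=
  (hG.iSupIndep.comp fun (a b : s) (hab : j - (a : ℕ) = j - (b : ℕ)) ↦
    Subtype.ext (by simpa using hab)).linearIndependent _
      (fun i ↦ hG.toEnd_f_pow_mem hp i) fun i ↦ hs i i.2

end IsSl2Grading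

namespace IsPrincipalGrading

variable {ι : W →ₗ[k] M} {N : End k W} {E : Finset ℕ} {u : ℕ → W} {m : ℕ}
  [FiniteDimensional k M] [FiniteDimensional k W]

theorem exists_primitive (hG : IsPrincipalGrading G h e f ι N E u) (hm : m ∈ E) :
    ∃ p ∈ G m, hG.toIsSl2Triple.HasPrimitiveVectorWith p (2 * m : k) := by
  obtain ⟨⟨p, hep, hp⟩, hne, -⟩ := finrank_eq_one_iff'.mp (hG.finrank_ker_toEnd_e_inf hm)
  exact ⟨p, hp, fun h0 ↦ hne (Subtype.ext h0), by simpa using hG.lie_h hp, hep⟩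

theorem ker_toEnd_e_inf_eq_span (hG : IsPrincipalGrading G h e f ι N E u) (hm : m ∈ E)
    (hp : p ∈ G m) (P : hG.toIsSl2Triple.HasPrimitiveVectorWith p (2 * m : k)) :
    LinearMap.ker (toEnd k L M e) ⊓ G m = k ∙ p := by
  refine (Submodule.eq_of_le_of_finrank_eq ?_ ?_).symm
  · exact (Submodule.span_singleton_le_iff_mem _ _).mpr ⟨P.lie_e, hp⟩
  · rw [finrank_span_singleton P.ne_zero, hG.finrank_ker_toEnd_e_inf hm]

theorem exists_toEnd_f_pow_eq_smul (hG : IsPrincipalGrading G h e f ι N E u) (hm : m ∈ E)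
    (hp : p ∈ G m) (P : hG.toIsSl2Triple.HasPrimitiveVectorWith p (2 * m : k)) :
    ∃ a : k, a ≠ 0 ∧ (toEnd k L M f ^ m) p = a • ι (u m) := by
  obtain ⟨i, rfl⟩ := Nat.exists_eq_add_one.mpr (hG.pos m hm)
  have hmem : (toEnd k L M f ^ (i + 1)) p ∈ G 0 := by simpa using hG.toEnd_f_pow_mem hp (i + 1)
  rw [← hG.range_eq] at hmem
  obtain ⟨w, hw⟩ := hmem
  have hN : N w = (((i + 1 : ℕ) : k) * ((i + 1 : ℕ) + 1)) • w := by
    apply hG.injective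
    rw [← hG.lie_f_lie_e, hw, P.lie_e_pow_succ_toEnd_f, lie_smul, ← toEnd_pow_succ_apply, map_smul,
      hw]
    push_cast
    ring_nf
  have hspan := mem_eigenspace_iff.mpr hN
  rw [hG.eigenspace_eq _ hm, Submodule.mem_span_singleton] at hspan
  obtain ⟨a, rfl⟩ := hspan
  refine ⟨a, ?_, by rw [← hw, map_smul]⟩
  rintro rfl
  rw [zero_smul, map_zero] at hw
  exact P.ne_zero (hG.eq_zero_of_toEnd_f_pow_eq_zero hp hw.symm)

theorem lowerSpan_inf_zero (hG : IsPrincipalGrading G h e f ι N E u) (hm : m ∈ E)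
    (hp : p ∈ G m) (P : hG.toIsSl2Triple.HasPrimitiveVectorWith p (2 * m : k)) :
    lowerSpan k f p ⊓ G 0 = k ∙ ι (u m) := by
  obtain ⟨a, ha, heq⟩ := hG.exists_toEnd_f_pow_eq_smul hm hp P
  have hinf := hG.lowerSpan_inf hp m
  rwa [sub_self, heq, Submodule.span_singleton_smul_eq ha.isUnit] at hinf

theorem lowerSpan_inf_neg_one (hG : IsPrincipalGrading G h e f ι N E u) (hm : m ∈ E)
    (hp : p ∈ G m) (P : hG.toIsSl2Triple.HasPrimitiveVectorWith p (2 * m : k)) :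
    lowerSpan k f p ⊓ G (-1) = k ∙ ⁅f, ι (u m)⁆ := by
  obtain ⟨a, ha, heq⟩ := hG.exists_toEnd_f_pow_eq_smul hm hp P
  have hinf := hG.lowerSpan_inf hp (m + 1)
  rwa [toEnd_pow_succ_apply, heq, lie_smul, Submodule.span_singleton_smul_eq ha.isUnit,
    Nat.cast_succ, sub_add_cancel_left] at hinf

theorem eigenvector_ne_zero (hG : IsPrincipalGrading G h e f ι N E u) (hm : m ∈ E) : u m ≠ 0 := by
  obtain ⟨p, hp, P⟩ := hG.exists_primitive hm
  obtain ⟨a, -, heq⟩ := hG.exists_toEnd_f_pow_eq_smul hm hp P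
  intro h0
  rw [h0, map_zero, smul_zero] at heq
  exact P.ne_zero (hG.eq_zero_of_toEnd_f_pow_eq_zero hp heq)

theorem toEnd_f_pow_eq_zero (hG : IsPrincipalGrading G h e f ι N E u)
    (hp : p ∈ G m) (P : hG.toIsSl2Triple.HasPrimitiveVectorWith p (2 * m : k)) :
    (toEnd k L M f ^ (2 * m + 1)) p = 0 := by
  refine hG.eq_zero_of_lie_e_eq_zero (j := m - (2 * m + 1 : ℕ)) (by omega)
    (hG.toEnd_f_pow_mem hp _) ?_
  rw [P.lie_e_pow_succ_toEnd_f]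
  simp

end IsPrincipalGrading

end PrimitiveInGrading

section DirectSum

open Finset Module Module.End LieModule

variable {k L M W : Type*} [Field k] [LieRing L] [LieAlgebra k L] [AddCommGroup M] [Module k M]
  [LieRingModule L M] [LieModule k L M] [AddCommGroup W] [Module k W] {G : ℤ → Submodule k M}
  {h e f : L} {ι : W →ₗ[k] M} {N : End k W} {E : Finset ℕ} {u : ℕ → W} {m : ℕ} {p : ℕ → M}

theorem lie_mem_iSup₂ {x : L} {α : Type*} {S : Finset α} {V : α → Submodule k M}
    (hV : ∀ i ∈ S, ∀ v ∈ V i, ⁅x, v⁆ ∈ V i) : ∀ v ∈ ⨆ i ∈ S, V i, ⁅x, v⁆ ∈ ⨆ i ∈ S, V i := by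
  suffices hle : ⨆ i ∈ S, V i ≤ (⨆ i ∈ S, V i).comap (toEnd k L M x) from fun v hv ↦ hle hv
  exact iSup₂_le fun i hi v hv ↦ le_iSup₂ (f := fun i (_ : i ∈ S) ↦ V i) i hi (hV i hi v hv)

namespace IsPrincipalGrading

variable [FiniteDimensional k M] [FiniteDimensional k W]

theorem span_image_eigenvector (hG : IsPrincipalGrading G h e f ι N E u)
    (hinj : Set.InjOn (fun m : ℕ ↦ (m : k) * (m + 1)) E) : Submodule.span k (u '' E) = ⊤ := by
  have hli : LinearIndependent k fun m : E ↦ u m :=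
    eigenvectors_linearIndependent' N _ hinj.injective _ fun m ↦
      ⟨mem_eigenspace_iff.mpr (hG.apply_eigenvector m.2), hG.eigenvector_ne_zero m.2⟩
  have hspan := hli.span_eq_top_of_card_eq_finrank' (by simpa using hG.finrank_eq.symm)
  rw [Set.image_eq_range]
  exact hspan

theorem iSup_lowerSpan (hG : IsPrincipalGrading G h e f ι N E u)
    (hinj : Set.InjOn (fun m : ℕ ↦ (m : k) * (m + 1)) E) (hp : ∀ m ∈ E, p m ∈ G m)
    (P : ∀ m ∈ E, hG.toIsSl2Triple.HasPrimitiveVectorWith (p m) (2 * m : k)) :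
    ⨆ m ∈ E, lowerSpan k f (p m) = ⊤ := by
  refine hG.eq_top_of_le (lie_mem_iSup₂ fun m hm v ↦ lie_e_mem_lowerSpan (P m hm))
    (lie_mem_iSup₂ fun m _ v ↦ lie_f_mem_lowerSpan) ?_
  rw [← hG.range_eq, LinearMap.range_eq_map, ← hG.span_image_eigenvector hinj,
    Submodule.map_span, Submodule.span_le]
  rintro _ ⟨_, ⟨m, hm, rfl⟩, rfl⟩
  refine le_iSup₂ (f := fun m (_ : m ∈ E) ↦ lowerSpan k f (p m)) m hm ?_
  have hmem := Submodule.mem_span_singleton_self (R := k) (ι (u m))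
  rw [← hG.lowerSpan_inf_zero hm (hp m hm) (P m hm)] at hmem
  exact hmem.1

theorem isCompl_lowerSpan (hG : IsPrincipalGrading G h e f ι N E u) (h2 : (2 : k) ≠ 0)
    (hinj : Set.InjOn (fun m : ℕ ↦ (m : k) * (m + 1)) E) (hp : ∀ m ∈ E, p m ∈ G m)
    (P : ∀ m ∈ E, hG.toIsSl2Triple.HasPrimitiveVectorWith (p m) (2 * m : k)) (hm : m ∈ E) :
    IsCompl (lowerSpan k f (p m)) (⨆ a ∈ E.erase m, lowerSpan k f (p a)) := by
  refine ⟨?_, codisjoint_iff.mpr ?_⟩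
  · refine (eigenspaces_iSupIndep (casimirEnd k M h e f) (2 * m * (2 * m + 2))).mono
      (lowerSpan_le_eigenspace (P m hm)) (iSup₂_le fun a ha ↦ ?_)
    obtain ⟨ham, ha⟩ := mem_erase.mp ha
    refine (lowerSpan_le_eigenspace (P a ha)).trans
      (le_iSup₂ (f := fun μ (_ : μ ≠ (2 * m * (2 * m + 2) : k)) ↦
        (casimirEnd k M h e f).eigenspace μ) _ fun heq ↦ ham (hinj ha hm ?_))
    refine mul_left_cancel₀ (mul_ne_zero h2 h2) ?_
    linear_combination heq
  · rw [← hG.iSup_lowerSpan hinj hp P, ← insert_erase hm, Finset.iSup_insert,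
      erase_insert_eq_erase, erase_idem]

end IsPrincipalGrading

end DirectSum

section Derivatives

open MvPolynomial

variable {R : Type*} [CommSemiring R]

theorem pderiv_zero_X_pow_mul_X_pow (a b : ℕ) :
    pderiv 0 (X 0 ^ a * X 1 ^ b : MvPolynomial (Fin 2) R) =
      (a : R) • (X 0 ^ (a - 1) * X 1 ^ b) := by
  rw [Derivation.leibniz, Derivation.leibniz_pow, Derivation.leibniz_pow, pderiv_X_self,
    pderiv_X_of_ne one_ne_zero, smul_zero, smul_zero, smul_zero, zero_add, smul_eq_mul, smul_eq_mul,
    mul_one, mul_smul_comm, mul_comm, Nat.cast_smul_eq_nsmul]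

theorem pderiv_one_X_pow_mul_X_pow (a b : ℕ) :
    pderiv 1 (X 0 ^ a * X 1 ^ b : MvPolynomial (Fin 2) R) =
      (b : R) • (X 0 ^ a * X 1 ^ (b - 1)) := by
  rw [Derivation.leibniz, Derivation.leibniz_pow, Derivation.leibniz_pow, pderiv_X_self,
    pderiv_X_of_ne zero_ne_one, smul_zero, smul_zero, smul_zero, add_zero, smul_eq_mul, smul_eq_mul,
    mul_one, mul_smul_comm, Nat.cast_smul_eq_nsmul]

theorem X_zero_mul_pderiv_zero (a b : ℕ) :
    X 0 * pderiv 0 (X 0 ^ a * X 1 ^ b : MvPolynomial (Fin 2) R) =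
      (a : R) • (X 0 ^ a * X 1 ^ b) := by
  rw [pderiv_zero_X_pow_mul_X_pow]
  cases a with
  | zero => simp
  | succ a => rw [mul_smul_comm, ← mul_assoc, add_tsub_cancel_right, ← pow_succ']

theorem X_one_mul_pderiv_one (a b : ℕ) :
    X 1 * pderiv 1 (X 0 ^ a * X 1 ^ b : MvPolynomial (Fin 2) R) =
      (b : R) • (X 0 ^ a * X 1 ^ b) := by
  rw [pderiv_one_X_pow_mul_X_pow]
  cases b with
  | zero => simp
  | succ b => rw [mul_smul_comm, mul_left_comm, add_tsub_cancel_right, ← pow_succ']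

end Derivatives

section SymPower

open Module Module.End LieModule MvPolynomial

variable {k L M : Type*} [Field k] [LieRing L] [LieAlgebra k L] [AddCommGroup M] [Module k M]
  [LieRingModule L M] [LieModule k L M] {h e f : L} {p : M} {d : ℕ} {q : MvPolynomial (Fin 2) k}

theorem add_eq_of_mem_support (hq : q.IsHomogeneous d) {s : Fin 2 →₀ ℕ} (hs : s ∈ q.support) :
    s 0 + s 1 = d := by
  rw [← Fin.sum_univ_two, ← Finsupp.degree_eq_sum]
  exact of_not_not fun hne ↦ mem_support_iff.mp hs (hq.coeff_eq_zero hne)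

theorem isHomogeneous_X_mul_pderiv (i j : Fin 2) (hq : q.IsHomogeneous d) :
    (X i * pderiv j q).IsHomogeneous d := by
  convert isHomogeneous_symAction (Matrix.single i j (1 : k)) hq
  simp [Matrix.single_apply, ite_and, apply_ite C]

theorem apply_eq_of_isHomogeneous {A B : MvPolynomial (Fin 2) k →ₗ[k] M}
    (hAB : ∀ a b : ℕ, a + b = d → A (X 0 ^ a * X 1 ^ b) = B (X 0 ^ a * X 1 ^ b))
    (hq : q.IsHomogeneous d) : A q = B q := by
  rw [q.as_sum, map_sum, map_sum]
  refine Finset.sum_congr rfl fun s hs ↦ ?_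
  rw [monomial_fin_two, mul_assoc, C_mul', map_smul, map_smul,
    hAB _ _ (add_eq_of_mem_support hq hs)]

variable (k) in
/-- The linear map with `x ^ a y ^ b ↦ a! f ^ b p`. On forms of degree `d` it intertwines the
actions of `sl₂` when `p` is primitive of weight `d` and `f ^ (d + 1) p = 0`. -/
noncomputable def symMap (f : L) (p : M) : MvPolynomial (Fin 2) k →ₗ[k] M :=
  (basisMonomials (Fin 2) k).constr k fun s ↦
    ((s 0).factorial : k) • (toEnd k L M f ^ s 1) p

theorem symMap_X_pow_mul_X_pow (f : L) (p : M) (a b : ℕ) :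
    symMap k f p (X 0 ^ a * X 1 ^ b) = (a.factorial : k) • (toEnd k L M f ^ b) p := by
  have hbasis : (X 0 ^ a * X 1 ^ b : MvPolynomial (Fin 2) k) =
      basisMonomials (Fin 2) k (Finsupp.single 0 a + Finsupp.single 1 b) := by
    simp [monomial_fin_two]
  rw [hbasis, symMap, Basis.constr_basis]
  simp

theorem symMap_X_zero_mul_pderiv_one {t : IsSl2Triple h e f}
    (P : t.HasPrimitiveVectorWith p (d : k)) (hq : q.IsHomogeneous d) :
    symMap k f p (X 0 * pderiv 1 q) = ⁅e, symMap k f p q⁆ := by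
  refine apply_eq_of_isHomogeneous
    (A := symMap k f p ∘ₗ LinearMap.mulLeft k (X 0) ∘ₗ (pderiv 1).toLinearMap)
    (B := toEnd k L M e ∘ₗ symMap k f p) (fun a b hab ↦ ?_) hq
  simp only [LinearMap.comp_apply, LinearMap.mulLeft_apply, Derivation.coeFn_coe,
    symMap_X_pow_mul_X_pow, toEnd_apply_apply, lie_smul]
  cases b with
  | zero => simp [P.lie_e]
  | succ b =>
    have hderiv : X 0 * pderiv 1 (X 0 ^ a * X 1 ^ (b + 1)) =
        (b + 1 : k) • (X 0 ^ (a + 1) * X 1 ^ b : MvPolynomial (Fin 2) k) := by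
      rw [pderiv_one_X_pow_mul_X_pow, mul_smul_comm, ← mul_assoc, ← pow_succ', Nat.cast_succ,
        add_tsub_cancel_right]
    rw [hderiv, map_smul, symMap_X_pow_mul_X_pow, P.lie_e_pow_succ_toEnd_f, smul_smul, smul_smul,
      Nat.factorial_succ, ← hab]
    congr 1
    push_cast
    ring

theorem symMap_X_one_mul_pderiv_zero (hd : (toEnd k L M f ^ (d + 1)) p = 0)
    (hq : q.IsHomogeneous d) : symMap k f p (X 1 * pderiv 0 q) = ⁅f, symMap k f p q⁆ := by
  refine apply_eq_of_isHomogeneous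
    (A := symMap k f p ∘ₗ LinearMap.mulLeft k (X 1) ∘ₗ (pderiv 0).toLinearMap)
    (B := toEnd k L M f ∘ₗ symMap k f p) (fun a b hab ↦ ?_) hq
  simp only [LinearMap.comp_apply, LinearMap.mulLeft_apply, Derivation.coeFn_coe,
    symMap_X_pow_mul_X_pow, toEnd_apply_apply, lie_smul, ← toEnd_pow_succ_apply (k := k)]
  cases a with
  | zero =>
    obtain rfl : b = d := by simpa using hab
    simp [hd]
  | succ a =>
    have hderiv : X 1 * pderiv 0 (X 0 ^ (a + 1) * X 1 ^ b) =
        (a + 1 : k) • (X 0 ^ a * X 1 ^ (b + 1) : MvPolynomial (Fin 2) k) := by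
      rw [pderiv_zero_X_pow_mul_X_pow, mul_smul_comm, mul_left_comm, ← pow_succ', Nat.cast_succ,
        add_tsub_cancel_right]
    rw [hderiv, map_smul, symMap_X_pow_mul_X_pow, smul_smul, Nat.factorial_succ]
    push_cast
    rfl

theorem symMap_X_mul_pderiv_sub {t : IsSl2Triple h e f}
    (P : t.HasPrimitiveVectorWith p (d : k)) (hq : q.IsHomogeneous d) :
    symMap k f p (X 0 * pderiv 0 q - X 1 * pderiv 1 q) = ⁅h, symMap k f p q⁆ := by
  suffices heq : ∀ a b : ℕ, a + b = d → symMap k f p (X 0 * pderiv 0 (X 0 ^ a * X 1 ^ b)) -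
      symMap k f p (X 1 * pderiv 1 (X 0 ^ a * X 1 ^ b)) = ⁅h, symMap k f p (X 0 ^ a * X 1 ^ b)⁆ by
    rw [map_sub]
    exact apply_eq_of_isHomogeneous
      (A := symMap k f p ∘ₗ LinearMap.mulLeft k (X 0) ∘ₗ (pderiv 0).toLinearMap -
        symMap k f p ∘ₗ LinearMap.mulLeft k (X 1) ∘ₗ (pderiv 1).toLinearMap)
      (B := toEnd k L M h ∘ₗ symMap k f p) heq hq
  intro a b hab
  rw [X_zero_mul_pderiv_zero, X_one_mul_pderiv_one, map_smul, map_smul, ← sub_smul,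
    symMap_X_pow_mul_X_pow, lie_smul, P.lie_h_pow_toEnd_f, smul_smul, smul_smul, ← hab]
  congr 1
  push_cast
  ring

theorem map_symMap_homogeneousSubmodule (hfac : (d.factorial : k) ≠ 0)
    (hd : (toEnd k L M f ^ (d + 1)) p = 0) :
    (homogeneousSubmodule (Fin 2) k d).map (symMap k f p) = lowerSpan k f p := by
  refine le_antisymm ?_ (lowerSpan_le ?_ ?_)
  · refine (LinearMap.map_le_range).trans ?_
    rw [symMap, Basis.constr_range, Submodule.span_le]
    rintro _ ⟨s, rfl⟩
    exact Submodule.smul_mem _ _ (Submodule.subset_span ⟨s 1, rfl⟩)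
  · refine ⟨(d.factorial : k)⁻¹ • X 0 ^ d,
      Submodule.smul_mem _ _ (isHomogeneous_X_pow 0 d), ?_⟩
    have hpow := symMap_X_pow_mul_X_pow (k := k) f p d 0
    rw [pow_zero, mul_one] at hpow
    rw [map_smul, hpow, smul_smul, inv_mul_cancel₀ hfac, one_smul, pow_zero, one_apply]
  · rintro _ ⟨q, hq, rfl⟩
    exact ⟨X 1 * pderiv 0 q, isHomogeneous_X_mul_pderiv 1 0 hq,
      symMap_X_one_mul_pderiv_zero hd hq⟩

theorem disjoint_homogeneousSubmodule_ker_symMap (hfac : (d.factorial : k) ≠ 0)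
    (hli : LinearIndepOn k (fun i : ℕ ↦ (toEnd k L M f ^ i) p) (Set.Iic d)) :
    Disjoint (homogeneousSubmodule (Fin 2) k d) (LinearMap.ker (symMap k f p)) := by
  rw [Submodule.disjoint_def]
  intro q hq hker
  have hinj : Set.InjOn (fun s : Fin 2 →₀ ℕ ↦ s 1) q.support := fun s hs t ht hst ↦ by
    have hs' := add_eq_of_mem_support hq hs
    have ht' := add_eq_of_mem_support hq ht
    ext i
    fin_cases i
    · exact Nat.add_right_cancel (hs'.trans (ht'.symm.trans (congrArg (t 0 + ·) hst.symm)))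
    · exact hst
  have hli' : LinearIndepOn k (fun s : Fin 2 →₀ ℕ ↦ (toEnd k L M f ^ s 1) p) q.support := by
    refine LinearIndepOn.comp_of_image (f := fun s : Fin 2 →₀ ℕ ↦ s 1) (hli.mono ?_) hinj
    rintro _ ⟨s, hs, rfl⟩
    exact (Nat.le_add_left _ _).trans (add_eq_of_mem_support hq hs).le
  have hsum : ∑ s ∈ q.support, (coeff s q * (s 0).factorial) • (toEnd k L M f ^ s 1) p = 0 := by
    rw [← LinearMap.mem_ker.mp hker, q.as_sum, map_sum]
    refine Finset.sum_congr (by rw [← q.as_sum]) fun s _ ↦ ?_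
    rw [monomial_fin_two, mul_assoc, C_mul', map_smul, symMap_X_pow_mul_X_pow, smul_smul,
      ← q.as_sum]
  ext s
  by_contra hs
  have hs' := mem_support_iff.mpr hs
  refine (mul_ne_zero hs ?_) (linearIndepOn_finset_iff.mp hli' _ hsum s hs')
  obtain ⟨c, hc⟩ := Nat.factorial_dvd_factorial
    ((Nat.le_add_right _ _).trans (add_eq_of_mem_support hq hs').le)
  rw [hc, Nat.cast_mul] at hfac
  exact left_ne_zero_of_mul hfac

end SymPower

section Sl2Submodule

open Module Module.End LieModule MvPolynomial

variable {k g : Type*} [Field k] [LieRing g] [LieAlgebra k g] {h e f p : g} {d : ℕ}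
  {φ : LieAlgebra.SpecialLinear.sl (Fin 2) k →ₗ⁅k⁆ g} {V W : Submodule k g}

theorem sl_two_apply_one_one (s : LieAlgebra.SpecialLinear.sl (Fin 2) k) :
    s.1 1 1 = -s.1 0 0 := by
  have htrace : s.1.trace = 0 := LinearMap.mem_ker.mp s.2
  rw [Matrix.trace_fin_two] at htrace
  linear_combination htrace

theorem lie_sl_two_apply (hφ : ∀ s, φ s = s.1 0 1 • e + s.1 0 0 • h + s.1 1 0 • f)
    (s : LieAlgebra.SpecialLinear.sl (Fin 2) k) (v : g) :
    ⁅φ s, v⁆ = s.1 0 1 • ⁅e, v⁆ + s.1 0 0 • ⁅h, v⁆ + s.1 1 0 • ⁅f, v⁆ := by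
  rw [hφ, add_lie, add_lie, smul_lie, smul_lie, smul_lie]

theorem isSl2Stable_iff (hφ : ∀ s, φ s = s.1 0 1 • e + s.1 0 0 • h + s.1 1 0 • f) :
    IsSl2Stable φ V ↔ ∀ v ∈ V, ⁅e, v⁆ ∈ V ∧ ⁅h, v⁆ ∈ V ∧ ⁅f, v⁆ ∈ V := by
  refine ⟨fun hV v hv ↦ ?_, fun hV s v hv ↦ ?_⟩
  · have he := hV (LieAlgebra.SpecialLinear.single 0 1 zero_ne_one 1) v hv
    have hh := hV (LieAlgebra.SpecialLinear.singleSubSingle 0 1 1) v hv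
    have hf := hV (LieAlgebra.SpecialLinear.single 1 0 one_ne_zero 1) v hv
    rw [lie_sl_two_apply hφ] at he hh hf
    simpa using And.intro he (And.intro hh hf)
  · obtain ⟨he, hh, hf⟩ := hV v hv
    rw [lie_sl_two_apply hφ]
    exact add_mem (add_mem (V.smul_mem _ he) (V.smul_mem _ hh)) (V.smul_mem _ hf)

theorem isSl2Stable_lowerSpan (hφ : ∀ s, φ s = s.1 0 1 • e + s.1 0 0 • h + s.1 1 0 • f)
    {t : IsSl2Triple h e f} {μ : k} (P : t.HasPrimitiveVectorWith p μ) :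
    IsSl2Stable φ (lowerSpan k f p) :=
  (isSl2Stable_iff hφ).mpr fun _ hv ↦
    ⟨lie_e_mem_lowerSpan P hv, lie_h_mem_lowerSpan P hv, lie_f_mem_lowerSpan hv⟩

theorem symAction_sl_two_coe (s : LieAlgebra.SpecialLinear.sl (Fin 2) k)
    (q : homogeneousSubmodule (Fin 2) k d) :
    (symAction d s.1 q : MvPolynomial (Fin 2) k) = s.1 0 1 • (X 0 * pderiv 1 q.1) +
      s.1 0 0 • (X 0 * pderiv 0 q.1 - X 1 * pderiv 1 q.1) + s.1 1 0 • (X 1 * pderiv 0 q.1) := by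
  simp only [symAction, Fin.sum_univ_two, C_mul', sl_two_apply_one_one]
  module

theorem symMap_symAction {t : IsSl2Triple h e f}
    (hφ : ∀ s, φ s = s.1 0 1 • e + s.1 0 0 • h + s.1 1 0 • f)
    (P : t.HasPrimitiveVectorWith p (d : k)) (hd : (toEnd k g g f ^ (d + 1)) p = 0)
    (s : LieAlgebra.SpecialLinear.sl (Fin 2) k) (q : homogeneousSubmodule (Fin 2) k d) :
    symMap k f p (symAction d s.1 q) = ⁅φ s, symMap k f p q⁆ := by
  rw [symAction_sl_two_coe, lie_sl_two_apply hφ, map_add, map_add, map_smul, map_smul, map_smul,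
    symMap_X_zero_mul_pderiv_one P q.2, symMap_X_mul_pderiv_sub P q.2,
    symMap_X_one_mul_pderiv_zero hd q.2]

theorem isSymPower_lowerSpan {t : IsSl2Triple h e f}
    (hφ : ∀ s, φ s = s.1 0 1 • e + s.1 0 0 • h + s.1 1 0 • f)
    (P : t.HasPrimitiveVectorWith p (d : k)) (hfac : (d.factorial : k) ≠ 0)
    (hd : (toEnd k g g f ^ (d + 1)) p = 0)
    (hli : LinearIndepOn k (fun i : ℕ ↦ (toEnd k g g f ^ i) p) (Set.Iic d)) :
    IsSymPower φ d (lowerSpan k f p) := by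
  refine ⟨isSl2Stable_lowerSpan hφ P, ?_⟩
  rw [← map_symMap_homogeneousSubmodule hfac hd]
  refine ⟨.ofBijective ((symMap k f p).submoduleMap _) ⟨?_, LinearMap.submoduleMap_surjective _ _⟩,
    fun s q ↦ symMap_symAction hφ P hd s q⟩
  refine (injective_iff_map_eq_zero _).mpr fun q hq ↦ Subtype.ext ?_
  exact Submodule.disjoint_def.mp (disjoint_homogeneousSubmodule_ker_symMap hfac hli) q q.2
    (congrArg Subtype.val hq)

theorem IsSymPower.exists_primitive (hφ : ∀ s, φ s = s.1 0 1 • e + s.1 0 0 • h + s.1 1 0 • f)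
    (hV : IsSymPower φ d V) : ∃ v ∈ V, v ≠ 0 ∧ ⁅e, v⁆ = 0 ∧ ⁅h, v⁆ = (d : k) • v := by
  obtain ⟨-, Φ, hΦ⟩ := hV
  let x : homogeneousSubmodule (Fin 2) k d := ⟨X 0 ^ d, isHomogeneous_X_pow 0 d⟩
  have hx : x ≠ 0 := fun h0 ↦ pow_ne_zero d (X_ne_zero (0 : Fin 2)) (congrArg Subtype.val h0)
  have he := hΦ (LieAlgebra.SpecialLinear.single 0 1 zero_ne_one 1) x
  have hh := hΦ (LieAlgebra.SpecialLinear.singleSubSingle 0 1 1) x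
  refine ⟨Φ x, (Φ x).2, fun h0 ↦ hx (Φ.map_eq_zero_iff.mp (Subtype.ext h0)), ?_, ?_⟩
  · have hex : symAction d (LieAlgebra.SpecialLinear.single 0 1 zero_ne_one (1 : k)).1 x = 0 :=
      Subtype.ext <| by
        rw [symAction_sl_two_coe]
        simp [x, Derivation.leibniz_pow]
    rw [hex, lie_sl_two_apply hφ] at he
    simpa using he.symm
  · have hhx : symAction d (LieAlgebra.SpecialLinear.singleSubSingle 0 1 (1 : k)).1 x =
        (d : k) • x := Subtype.ext <| by
      rw [symAction_sl_two_coe]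
      simpa [x, Derivation.leibniz_pow] using X_zero_mul_pderiv_zero (R := k) d 0
    rw [hhx, lie_sl_two_apply hφ] at hh
    simpa using hh.symm

end Sl2Submodule

namespace IsPrincipalGrading

open Module

variable {k g W : Type*} [Field k] [LieRing g] [LieAlgebra k g] [AddCommGroup W] [Module k W]
  [FiniteDimensional k g] [FiniteDimensional k W] {G : ℤ → Submodule k g} {h e f p : g}
  {ι : W →ₗ[k] g} {N : End k W} {E : Finset ℕ} {u : ℕ → W} {m : ℕ}
  {φ : LieAlgebra.SpecialLinear.sl (Fin 2) k →ₗ⁅k⁆ g} {V : Submodule k g}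

theorem isSymPower_lowerSpan (hG : IsPrincipalGrading G h e f ι N E u)
    (hφ : ∀ s, φ s = s.1 0 1 • e + s.1 0 0 • h + s.1 1 0 • f) (hp : p ∈ G m)
    (P : hG.toIsSl2Triple.HasPrimitiveVectorWith p (2 * m : k))
    (hfac : ((2 * m).factorial : k) ≠ 0) : IsSymPower φ (2 * m) (lowerSpan k f p) := by
  have P' : hG.toIsSl2Triple.HasPrimitiveVectorWith p ((2 * m : ℕ) : k) := by
    simpa using P
  exact _root_.isSymPower_lowerSpan hφ P' hfac (hG.toEnd_f_pow_eq_zero hp P)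
    (hG.linearIndepOn_toEnd_f_pow hp fun i hi ↦ toEnd_f_pow_ne_zero P' hfac hi)

theorem eq_lowerSpan_of_isSymPower (hG : IsPrincipalGrading G h e f ι N E u)
    (hφ : ∀ s, φ s = s.1 0 1 • e + s.1 0 0 • h + s.1 1 0 • f)
    (hinj : ∀ m ∈ E, Set.InjOn (Nat.cast : ℕ → k) (Set.Iic m)) (h2 : (2 : k) ≠ 0)
    (hm : m ∈ E) (hp : p ∈ G m) (P : hG.toIsSl2Triple.HasPrimitiveVectorWith p (2 * m : k))
    (hfac : ((2 * m).factorial : k) ≠ 0) (hV : IsSymPower φ (2 * m) V) :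
    V = lowerSpan k f p := by
  obtain ⟨v, hv, hv0, hev, hhv⟩ := hV.exists_primitive hφ
  have hvp : v ∈ k ∙ p := by
    rw [← hG.ker_toEnd_e_inf_eq_span hm hp P]
    exact ⟨hev, hG.mem_of_lie_e_eq_zero hinj h2 hm hev (by simpa using hhv)⟩
  obtain ⟨a, rfl⟩ := Submodule.mem_span_singleton.mp hvp
  have hpV : p ∈ V := (V.smul_mem_iff (left_ne_zero_of_smul hv0)).mp hv
  have hle : lowerSpan k f p ≤ V :=
    lowerSpan_le hpV fun v hv ↦ ((isSl2Stable_iff hφ).mp hV.1 v hv).2.2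
  obtain ⟨-, Φ, -⟩ := hV
  obtain ⟨-, Ψ, -⟩ := hG.isSymPower_lowerSpan hφ hp P hfac
  exact (Submodule.eq_of_le_of_finrank_eq hle (Ψ.symm.trans Φ).finrank_eq).symm

end IsPrincipalGrading

section Roots

open Finset

variable {n : ℕ} {A : Matrix (Fin n) (Fin n) ℤ}

theorem pairSimpleCoroot_neg (v : Fin n → ℤ) (i : Fin n) :
    pairSimpleCoroot A (-v) i = -pairSimpleCoroot A v i := by
  simp [pairSimpleCoroot]

theorem pairSimpleRoot_neg (w : Fin n → ℤ) (i : Fin n) :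
    pairSimpleRoot A i (-w) = -pairSimpleRoot A i w := by
  simp [pairSimpleRoot]

theorem pairSimpleCoroot_single (i j : Fin n) :
    pairSimpleCoroot A (Pi.single i 1) j = A i j := by
  simp [pairSimpleCoroot, Pi.single_apply]

theorem pairSimpleRoot_single (i j : Fin n) : pairSimpleRoot A i (Pi.single j 1) = A i j := by
  simp [pairSimpleRoot, Pi.single_apply]

/-- The `i`-th simple reflection, applied to a root and its coroot. -/
def reflectPair (A : Matrix (Fin n) (Fin n) ℤ) (i : Fin n)
    (p : (Fin n → ℤ) × (Fin n → ℤ)) : (Fin n → ℤ) × (Fin n → ℤ) :=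
  (p.1 - pairSimpleCoroot A p.1 i • Pi.single i 1, p.2 - pairSimpleRoot A i p.2 • Pi.single i 1)

theorem reflectPair_neg (i : Fin n) (p : (Fin n → ℤ) × (Fin n → ℤ)) :
    reflectPair A i (-p) = -reflectPair A i p := by
  ext : 1 <;>
    simp only [reflectPair, Prod.fst_neg, Prod.snd_neg, pairSimpleCoroot_neg,
      pairSimpleRoot_neg] <;>
    module

theorem reflectPair_single {i : Fin n} (hi : A i i = 2) :
    reflectPair A i (Pi.single i 1, Pi.single i 1) = -(Pi.single i 1, Pi.single i 1) := by
  ext : 1 <;>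
    simp only [reflectPair, Prod.fst_neg, Prod.snd_neg, pairSimpleCoroot_single,
      pairSimpleRoot_single, hi] <;>
    module

/-- A list of pairs of a root and its coroot that contains the simple ones and in which the `i`-th
simple reflection moves only the `i`-th simple pair out of the list. The positive roots of a root
system with Cartan matrix `A` have this property. -/
structure IsPositiveSystem (A : Matrix (Fin n) (Fin n) ℤ)
    (P : List ((Fin n → ℤ) × (Fin n → ℤ))) : Prop where
  diag : ∀ i, A i i = 2
  simple_mem : ∀ i, (Pi.single i 1, Pi.single i 1) ∈ P
  reflect_mem : ∀ p ∈ P, ∀ i, p = (Pi.single i 1, Pi.single i 1) ∨ reflectPair A i p ∈ P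

/-- The height of a root, the sum of its coefficients in the basis of simple roots. -/
def Root.height (α : Root A) : ℤ := ∑ j, α.root j

@[simp]
theorem height_simpleRoot (i : Fin n) : (simpleRoot A i).height = 1 := by
  simp [Root.height, simpleRoot]

@[simp]
theorem height_negSimpleRoot (i : Fin n) : (negSimpleRoot A i).height = -1 := by
  simp [Root.height, negSimpleRoot]

theorem simpleRoot_injective : Function.Injective (simpleRoot A) := fun i j hij ↦ by
  simpa [simpleRoot, Pi.single_apply] using congrFun (congrArg Root.root hij) i

theorem negSimpleRoot_injective : Function.Injective (negSimpleRoot A) := fun i j hij ↦ by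
  simpa [negSimpleRoot, Pi.single_apply] using congrFun (congrArg Root.root hij) i

theorem Root.injective_root_coroot :
    Function.Injective fun α : Root A ↦ (α.root, α.coroot) := by
  rintro ⟨v, w, hα⟩ ⟨v', w', hβ⟩ h
  simp only [Prod.mk.injEq] at h
  simp [h]

/-- The numbers of roots of given height are bounded by the dual of the partition `E`, as they are
when `E` is the set of exponents of the root system (a theorem of Kostant). -/
structure HasExponentHeights (A : Matrix (Fin n) (Fin n) ℤ) (E : Finset ℕ) : Prop where
  finite_root : Finite (Root A)
  height_ne_zero : ∀ α : Root A, α.height ≠ 0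
  ncard_height_eq_le : ∀ i : ℤ, i ≠ 0 →
    {α : Root A | α.height = i}.ncard ≤ #{m ∈ E | i.natAbs ≤ m}

namespace IsPositiveSystem

variable {P : List ((Fin n → ℤ) × (Fin n → ℤ))}

theorem reflectPair_mem_or_neg_mem (hP : IsPositiveSystem A P) {p : (Fin n → ℤ) × (Fin n → ℤ)}
    (hp : p ∈ P) (i : Fin n) : reflectPair A i p ∈ P ∨ -reflectPair A i p ∈ P := by
  obtain rfl | h := hP.reflect_mem p hp i
  · right
    rwa [reflectPair_single (hP.diag i), neg_neg]
  · exact .inl h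

theorem mem_or_neg_mem (hP : IsPositiveSystem A P) {v w : Fin n → ℤ} (h : IsRootPair A v w) :
    (v, w) ∈ P ∨ -(v, w) ∈ P := by
  induction h with
  | simple i => exact .inl (hP.simple_mem i)
  | neg _ ih => simpa [or_comm] using ih
  | reflect i _ ih =>
    obtain h | h := ih
    · exact hP.reflectPair_mem_or_neg_mem h i
    · have h' := hP.reflectPair_mem_or_neg_mem h i
      rw [reflectPair_neg, neg_neg] at h'
      exact h'.symm

variable {E : Finset ℕ}

theorem finite_root (hP : IsPositiveSystem A P) : Finite (Root A) := by
  have hfin : {p | p ∈ P ∨ -p ∈ P}.Finite :=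
    P.finite_toSet.union (P.finite_toSet.preimage neg_injective.injOn)
  exact Set.finite_univ_iff.mp <| (hfin.preimage Root.injective_root_coroot.injOn).subset
    fun α _ ↦ hP.mem_or_neg_mem α.isRootPair

theorem sign_smul_mem (hP : IsPositiveSystem A P) (hpos : ∀ p ∈ P, 0 < ∑ j, p.1 j) (α : Root A) :
    α.height.sign • (α.root, α.coroot) ∈ P := by
  obtain h | h := hP.mem_or_neg_mem α.isRootPair
  · have hα : 0 < α.height := hpos _ h
    simpa [Int.sign_eq_one_of_pos hα] using h
  · have hα : α.height < 0 := by simpa [Root.height] using hpos _ h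
    simpa [Int.sign_eq_neg_one_of_neg hα] using h

theorem hasExponentHeights (hP : IsPositiveSystem A P) (hpos : ∀ p ∈ P, 0 < ∑ j, p.1 j)
    (hE : ∀ p ∈ P, P.countP (fun q ↦ ∑ j, q.1 j = ∑ j, p.1 j) ≤
      #{m ∈ E | (∑ j, p.1 j).toNat ≤ m}) :
    HasExponentHeights A E := by
  have height_smul (α : Root A) : ∑ j, (α.height.sign • (α.root, α.coroot)).1 j =
      (α.height.natAbs : ℤ) := by
    rw [← Int.sign_mul_self, Root.height, mul_sum]
    rfl
  have height_ne_zero (α : Root A) : α.height ≠ 0 := by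
    have := hpos _ (hP.sign_smul_mem hpos α)
    rw [height_smul] at this
    omega
  refine ⟨hP.finite_root, height_ne_zero, fun i hi ↦ ?_⟩
  obtain hempty | ⟨β, rfl⟩ := {α : Root A | α.height = i}.eq_empty_or_nonempty
  · simp [hempty]
  have hβ := hE _ (hP.sign_smul_mem hpos β)
  simp only [height_smul, Int.toNat_natCast] at hβ
  refine le_trans ?_ hβ
  rw [List.countP_eq_length_filter]
  refine le_trans ?_ (List.toFinset_card_le _)
  rw [← Set.ncard_coe_finset]
  refine Set.ncard_le_ncard_of_injOn (fun α ↦ α.height.sign • (α.root, α.coroot))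
    (fun α (hα : α.height = β.height) ↦ ?_) fun α hα α' hα' h ↦ ?_
  · simp only [List.coe_toFinset, List.mem_filter, decide_eq_true_eq, Set.mem_ofPred_eq]
    exact ⟨hP.sign_smul_mem hpos α, by rw [height_smul, hα]⟩
  · rw [Set.mem_ofPred_eq] at hα hα'
    simp only [hα, hα'] at h
    exact Root.injective_root_coroot (smul_right_injective _ (by simpa using hi) h)

end IsPositiveSystem

end Roots

/-- The degree of an element of a Chevalley basis in the principal grading: zero on the Cartan
subalgebra, and the height of the root on a root vector. -/
def basisDegree {n : ℕ} (A : Matrix (Fin n) (Fin n) ℤ) : Fin n ⊕ Root A → ℤ :=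
  Sum.elim 0 Root.height

/-- The endomorphism that `ad Y ∘ ad X` induces on the Cartan subalgebra, in the coordinates of the
simple coroot vectors, for `X = ∑ X_α` and `Y = ∑ c_α X_{-α}`. -/
def principalEnd {n : ℕ} (A : Matrix (Fin n) (Fin n) ℤ) {k : Type*} [CommRing k] (c : Fin n → k) :
    Module.End k (Fin n → k) :=
  Matrix.toLin' (Matrix.diagonal c * A.map (↑))

theorem principalEnd_apply {n : ℕ} (A : Matrix (Fin n) (Fin n) ℤ) {k : Type*} [CommRing k]
    (c u : Fin n → k) (i : Fin n) : principalEnd A c u i = c i * ∑ j, A i j * u j := by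
  rw [principalEnd, Matrix.toLin'_apply, ← Matrix.mulVec_mulVec, Matrix.mulVec_diagonal]
  rfl

theorem Root.height_eq_of_root_add_eq {n : ℕ} {A : Matrix (Fin n) (Fin n) ℤ} {α β γ : Root A}
    (h : α.root + β.root = γ.root) : γ.height = α.height + β.height := by
  simp only [Root.height, ← h, Pi.add_apply, Finset.sum_add_distrib]

theorem isSl2Triple_sl_two {k : Type*} [CommRing k] [Nontrivial k] :
    IsSl2Triple (LieAlgebra.SpecialLinear.singleSubSingle (0 : Fin 2) 1 (1 : k))
      (LieAlgebra.SpecialLinear.single (0 : Fin 2) 1 zero_ne_one (1 : k))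
      (LieAlgebra.SpecialLinear.single (1 : Fin 2) 0 one_ne_zero (1 : k)) where
  h_ne_zero h := by simpa using congrFun (congrFun (congrArg Subtype.val h) 0) 0
  lie_e_f := by
    ext : 1
    simp [Ring.lie_def]
  lie_h_e_nsmul := by
    ext : 1
    simp [Ring.lie_def, sub_mul, mul_sub, two_smul]
  lie_h_f_nsmul := by
    ext : 1
    simp [Ring.lie_def, sub_mul, mul_sub, two_smul, ← sub_eq_add_neg]

namespace HasExponentHeights

variable {n : ℕ} {A : Matrix (Fin n) (Fin n) ℤ} {E : Finset ℕ}

theorem bddAbove_rootString (hA : HasExponentHeights A E) (α β : Root A) :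
    BddAbove {q : ℕ | ∃ δ : Root A, δ.root = β.root - q • α.root} := by
  have := hA.finite_root
  have hα : α.root ≠ 0 := fun h0 ↦ hA.height_ne_zero α (by simp [Root.height, h0])
  have hinj : Function.Injective fun q : ℕ ↦ β.root - q • α.root := fun q r hqr ↦ by
    have hsmul : (q : ℤ) • α.root = (r : ℤ) • α.root := by
      simpa only [natCast_zsmul] using sub_right_injective hqr
    exact Nat.cast_injective (smul_left_injective ℤ hα hsmul)
  exact ((Set.finite_range Root.root).preimage hinj.injOn).bddAbove

end HasExponentHeights

namespace ChevalleyBasis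

open Module Submodule LieAlgebra.SpecialLinear

variable {n : ℕ} {A : Matrix (Fin n) (Fin n) ℤ} {k g : Type*} [Field k] [LieRing g]
  [LieAlgebra k g] (B : ChevalleyBasis A k g)

theorem lie_h_simple (i j : Fin n) :
    ⁅B.basis (.inl j), B.basis (.inr (simpleRoot A i))⁆ =
      (A i j : k) • B.basis (.inr (simpleRoot A i)) := by
  rw [B.lie_h_x, Int.cast_smul_eq_zsmul, simpleRoot, pairSimpleCoroot_single]

theorem lie_h_negSimple (i j : Fin n) :
    ⁅B.basis (.inl j), B.basis (.inr (negSimpleRoot A i))⁆ =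
      -((A i j : k) • B.basis (.inr (negSimpleRoot A i))) := by
  rw [B.lie_h_x, Int.cast_smul_eq_zsmul, negSimpleRoot, pairSimpleCoroot_neg,
    pairSimpleCoroot_single, neg_smul]

theorem lie_principalH_simple (i : Fin n) :
    ⁅B.principalH, B.basis (.inr (simpleRoot A i))⁆ =
      (∑ j, A i j * twoRhoCheck A j : k) • B.basis (.inr (simpleRoot A i)) := by
  rw [principalH, sum_lie, Finset.sum_smul]
  refine Finset.sum_congr rfl fun j _ ↦ ?_
  rw [← Int.cast_smul_eq_zsmul k, smul_lie, lie_h_simple, smul_smul, mul_comm]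

theorem linearIndependent_simple :
    LinearIndependent k fun i ↦ B.basis (.inr (simpleRoot A i)) :=
  B.basis.linearIndependent.comp (fun i ↦ .inr (simpleRoot A i))
    (Sum.inr_injective.comp simpleRoot_injective)

variable {B} {φ : sl (Fin 2) k →ₗ⁅k⁆ g}

theorem isSl2Triple [NeZero n] (hφ : B.IsPrincipal φ) (h2 : (2 : k) ≠ 0) :
    IsSl2Triple B.principalH B.principalX B.principalY := by
  have hH : φ (singleSubSingle 0 1 1) = B.principalH := by simp [hφ _]
  have hX : φ (single 0 1 zero_ne_one 1) = B.principalX := by simp [hφ _]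
  have hY : φ (single 1 0 one_ne_zero 1) = B.principalY := by simp [hφ _]
  have ht := isSl2Triple_sl_two (k := k)
  have hHX : ⁅B.principalH, B.principalX⁆ = 2 • B.principalX := by
    rw [← hH, ← hX, ← LieHom.map_lie, ht.lie_h_e_nsmul, map_nsmul]
  refine ⟨fun h0 ↦ ?_, ?_, hHX, ?_⟩
  · have hX0 : ∑ i, (2 : k) • B.basis (.inr (simpleRoot A i)) = 0 := by
      rw [← Finset.smul_sum, ofNat_smul_eq_nsmul, ← principalX, ← hHX, h0, zero_lie]
    exact h2 (Fintype.linearIndependent_iff.mp B.linearIndependent_simple _ hX0 0)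
  · rw [← hX, ← hY, ← LieHom.map_lie, ht.lie_e_f, hH]
  · rw [← hH, ← hY, ← LieHom.map_lie, ht.lie_h_f_nsmul, map_neg, map_nsmul]

theorem sum_mul_twoRhoCheck [NeZero n] (hφ : B.IsPrincipal φ) (h2 : (2 : k) ≠ 0) (i : Fin n) :
    ∑ j, (A i j * twoRhoCheck A j : k) = 2 := by
  have hHX := (isSl2Triple hφ h2).lie_h_e_nsmul
  simp only [principalX, lie_sum, lie_principalH_simple, ← ofNat_smul_eq_nsmul k,
    Finset.smul_sum] at hHX
  rw [← sub_eq_zero, ← Finset.sum_sub_distrib] at hHX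
  simp only [← sub_smul] at hHX
  exact sub_eq_zero.mp (Fintype.linearIndependent_iff.mp B.linearIndependent_simple _ hHX i)

theorem lie_principalH_basis [NeZero n] (hφ : B.IsPrincipal φ) (h2 : (2 : k) ≠ 0)
    (b : Fin n ⊕ Root A) :
    ⁅B.principalH, B.basis b⁆ = (2 * basisDegree A b : k) • B.basis b := by
  rcases b with i | α
  · rw [principalH, sum_lie]
    simp [smul_lie, B.lie_h_h, basisDegree]
  · have hpair : ∑ j, (twoRhoCheck A j * pairSimpleCoroot A α.root j : k) = 2 * α.height := by
      calc ∑ j, (twoRhoCheck A j * pairSimpleCoroot A α.root j : k)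
          = ∑ i, α.root i * ∑ j, (A i j * twoRhoCheck A j : k) := by
            simp only [pairSimpleCoroot, Int.cast_sum, Int.cast_mul, Finset.mul_sum]
            rw [Finset.sum_comm]
            exact Finset.sum_congr rfl fun i _ ↦ Finset.sum_congr rfl fun j _ ↦ by ring
        _ = 2 * α.height := by
            simp only [sum_mul_twoRhoCheck hφ h2, ← Finset.sum_mul, Root.height, Int.cast_sum]
            ring
    rw [basisDegree, Sum.elim_inr, ← hpair, principalH, sum_lie, Finset.sum_smul]
    refine Finset.sum_congr rfl fun j _ ↦ ?_
    rw [← Int.cast_smul_eq_zsmul k, smul_lie, B.lie_h_x, ← Int.cast_smul_eq_zsmul k, smul_smul]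

variable (B)

/-- The part of degree `j` of the principal grading of `g`, in which the root space of `α` has
degree the height of `α`. -/
def degreeSpace (j : ℤ) : Submodule k g :=
  span k (B.basis '' {b | basisDegree A b = j})

theorem basis_mem_degreeSpace (b : Fin n ⊕ Root A) :
    B.basis b ∈ B.degreeSpace (basisDegree A b) :=
  subset_span ⟨b, rfl, rfl⟩

theorem iSup_degreeSpace : ⨆ j, B.degreeSpace j = ⊤ := by
  rw [← top_le_iff, ← B.basis.span_eq, span_le]
  rintro _ ⟨b, rfl⟩
  exact mem_iSup_of_mem _ (B.basis_mem_degreeSpace b)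

theorem iSupIndep_degreeSpace : iSupIndep B.degreeSpace := by
  intro i
  simp only [degreeSpace, ← span_iUnion, ← Set.image_iUnion]
  refine B.basis.linearIndependent.disjoint_span_image (Set.disjoint_left.mpr ?_)
  intro b hb hb'
  simp only [Set.mem_iUnion] at hb'
  obtain ⟨j, hji, hj⟩ := hb'
  exact hji (Eq.trans (Eq.symm hj) hb)

theorem lie_mem_degreeSpace {x : g} {d j : ℤ} {v : g}
    (hx : ∀ b, ⁅x, B.basis b⁆ ∈ B.degreeSpace (basisDegree A b + d)) (hv : v ∈ B.degreeSpace j) :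
    ⁅x, v⁆ ∈ B.degreeSpace (j + d) := by
  have hle : B.degreeSpace j ≤ (B.degreeSpace (j + d)).comap (LieAlgebra.ad k g x) := by
    rw [degreeSpace, span_le]
    rintro _ ⟨b, rfl, rfl⟩
    exact hx b
  exact hle hv

variable {E : Finset ℕ}

theorem lie_root_root_mem (hA : HasExponentHeights A E) (α β : Root A) :
    ⁅B.basis (.inr α), B.basis (.inr β)⁆ ∈ B.degreeSpace (β.height + α.height) := by
  by_cases h0 : α.root + β.root = 0
  · have hdeg : β.height + α.height = 0 := by
      simp [Root.height, ← Finset.sum_add_distrib, ← Pi.add_apply, add_comm β.root, h0]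
    rw [B.lie_x_neg α β h0, hdeg]
    exact sum_mem fun i _ ↦ zsmul_mem (B.basis_mem_degreeSpace (.inl i)) _
  by_cases hγ : ∃ γ : Root A, γ.root = α.root + β.root
  · obtain ⟨γ, hγ⟩ := hγ
    have hmem : B.basis (.inr γ) ∈ B.degreeSpace (β.height + α.height) := by
      rw [add_comm, ← Root.height_eq_of_root_add_eq hγ.symm]
      exact B.basis_mem_degreeSpace (.inr γ)
    have hne : {q : ℕ | ∃ δ : Root A, δ.root = β.root - q • α.root}.Nonempty := ⟨0, β, by simp⟩
    have hstring := Nat.sSup_mem hne (hA.bddAbove_rootString α β)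
    obtain h | h := B.lie_x_x α β γ hγ.symm _
      ⟨hstring, fun q hq ↦ le_csSup (hA.bddAbove_rootString α β) hq⟩ <;> rw [h]
    exacts [nsmul_mem hmem _, neg_mem (nsmul_mem hmem _)]
  · rw [B.lie_x_x_zero α β h0 fun γ h ↦ hγ ⟨γ, h⟩]
    exact zero_mem _

theorem lie_root_basis_mem (hA : HasExponentHeights A E) (α : Root A) (b : Fin n ⊕ Root A) :
    ⁅B.basis (.inr α), B.basis b⁆ ∈ B.degreeSpace (basisDegree A b + α.height) := by
  rcases b with i | β
  · rw [← lie_skew, B.lie_h_x]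
    refine neg_mem (zsmul_mem ?_ _)
    simpa [basisDegree] using B.basis_mem_degreeSpace (.inr α)
  · exact B.lie_root_root_mem hA α β

theorem isSl2Grading [NeZero n] {B : ChevalleyBasis A k g} (hφ : B.IsPrincipal φ)
    (h2 : (2 : k) ≠ 0) (hA : HasExponentHeights A E) :
    IsSl2Grading B.degreeSpace B.principalH B.principalX B.principalY where
  toIsSl2Triple := isSl2Triple hφ h2
  iSupIndep := B.iSupIndep_degreeSpace
  iSup_eq_top := B.iSup_degreeSpace
  lie_h {j v} hv := by
    have hle : B.degreeSpace j ≤ End.eigenspace (LieAlgebra.ad k g B.principalH) (2 * j : k) := by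
      rw [degreeSpace, span_le]
      rintro _ ⟨b, rfl, rfl⟩
      exact End.mem_eigenspace_iff.mpr (lie_principalH_basis hφ h2 b)
    exact End.mem_eigenspace_iff.mp (hle hv)
  lie_e_mem hv := B.lie_mem_degreeSpace (fun b ↦ by
    rw [principalX, sum_lie]
    exact sum_mem fun i _ ↦ by simpa using B.lie_root_basis_mem hA (simpleRoot A i) b) hv
  lie_f_mem hv := B.lie_mem_degreeSpace (fun b ↦ by
    rw [principalY, sum_lie]
    refine sum_mem fun i _ ↦ ?_
    rw [← Int.cast_smul_eq_zsmul k, smul_lie]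
    exact smul_mem _ _ (by simpa using B.lie_root_basis_mem hA (negSimpleRoot A i) b)) hv

end ChevalleyBasis

noncomputable section

namespace ChevalleyBasis

open Module Submodule
open scoped Finset

variable {n : ℕ} {A : Matrix (Fin n) (Fin n) ℤ} {k g : Type*} [Field k] [LieRing g]
  [LieAlgebra k g] (B : ChevalleyBasis A k g) {E : Finset ℕ}

/-- The parametrization of the Cartan subalgebra by coordinates in the simple coroot vectors. -/
def cartanMap : (Fin n → k) →ₗ[k] g :=
  Fintype.linearCombination k fun i ↦ B.basis (.inl i)

/-- The parametrization of the sum of the root spaces of the negatives of the simple roots by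
coordinates in the root vectors. -/
def negSimpleMap : (Fin n → k) →ₗ[k] g :=
  Fintype.linearCombination k fun i ↦ B.basis (.inr (negSimpleRoot A i))

theorem cartanMap_injective : Function.Injective B.cartanMap :=
  (B.basis.linearIndependent.comp _ Sum.inl_injective).fintypeLinearCombination_injective

theorem range_cartanMap : LinearMap.range B.cartanMap = B.cartanSpace :=
  Fintype.range_linearCombination k _

theorem range_negSimpleMap : LinearMap.range B.negSimpleMap = B.negSimpleSpace :=
  Fintype.range_linearCombination k _

theorem repr_negSimpleMap (w : Fin n → k) (i : Fin n) :
    B.basis.repr (B.negSimpleMap w) (.inr (negSimpleRoot A i)) = w i := by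
  classical
  simp [negSimpleMap, Fintype.linearCombination_apply, Finsupp.single_apply,
    negSimpleRoot_injective.eq_iff]

theorem negSimpleSpace_le_degreeSpace : B.negSimpleSpace ≤ B.degreeSpace (-1) := by
  refine span_le.mpr ?_
  rintro _ ⟨i, rfl⟩
  simpa [basisDegree] using B.basis_mem_degreeSpace (.inr (negSimpleRoot A i))

theorem cartanSpace_eq_degreeSpace (hA : HasExponentHeights A E) :
    B.cartanSpace = B.degreeSpace 0 := by
  have hset : {b | basisDegree A b = 0} = Set.range Sum.inl := by
    ext (i | α) <;> simp [basisDegree, hA.height_ne_zero]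
  rw [cartanSpace, degreeSpace, hset, ← Set.range_comp, Function.comp_def]

theorem finiteDimensional (B : ChevalleyBasis A k g) (hA : HasExponentHeights A E) :
    FiniteDimensional k g :=
  have := hA.finite_root
  .of_basis B.basis

theorem finrank_degreeSpace_le (hA : HasExponentHeights A E) (hn : n = #E) (j : ℤ) :
    finrank k (B.degreeSpace j) ≤ #{m ∈ E | j.natAbs ≤ m} := by
  obtain rfl | hj := eq_or_ne j 0
  · rw [← B.cartanSpace_eq_degreeSpace hA, ← range_cartanMap,
      LinearMap.finrank_range_of_inj B.cartanMap_injective]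
    simp [hn]
  · have := hA.finite_root
    have hset : {b | basisDegree A b = j} = Sum.inr '' {α | α.height = j} := by
      ext (i | α) <;> simp [basisDegree, hj.symm]
    have := Fintype.ofFinite {α : Root A | α.height = j}
    rw [degreeSpace, hset, ← Set.image_comp, Set.image_eq_range]
    refine (finrank_range_le_card _).trans ?_
    rw [← Nat.card_eq_fintype_card]
    exact hA.ncard_height_eq_le j hj

theorem lie_simple_negSimple (hA : HasExponentHeights A E) (i j : Fin n) :
    ⁅B.basis (.inr (simpleRoot A i)), B.basis (.inr (negSimpleRoot A j))⁆ =
      if i = j then B.basis (.inl j) else 0 := by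
  split_ifs with hij
  · subst hij
    rw [B.lie_x_neg _ _ (by simp [simpleRoot, negSimpleRoot])]
    simp [simpleRoot, Pi.single_apply]
  · refine B.lie_x_x_zero _ _ (fun h0 ↦ ?_) fun γ hγ ↦ hA.height_ne_zero γ ?_
    · have h0i := congrFun h0 i
      simp [simpleRoot, negSimpleRoot, hij] at h0i
    · simpa using Root.height_eq_of_root_add_eq hγ.symm

theorem lie_principalX_negSimpleMap (hA : HasExponentHeights A E) (w : Fin n → k) :
    ⁅B.principalX, B.negSimpleMap w⁆ = B.cartanMap w := by
  simp [principalX, negSimpleMap, cartanMap, Fintype.linearCombination_apply, sum_lie, lie_sum,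
    B.lie_simple_negSimple hA]

theorem lie_cartanMap_simple (w : Fin n → k) (i : Fin n) :
    ⁅B.cartanMap w, B.basis (.inr (simpleRoot A i))⁆ =
      (∑ j, A i j * w j : k) • B.basis (.inr (simpleRoot A i)) := by
  simp only [cartanMap, Fintype.linearCombination_apply, sum_lie, smul_lie, lie_h_simple, smul_smul,
    Finset.sum_smul, mul_comm]

theorem lie_cartanMap_negSimple (w : Fin n → k) (i : Fin n) :
    ⁅B.cartanMap w, B.basis (.inr (negSimpleRoot A i))⁆ =
      -((∑ j, A i j * w j : k) • B.basis (.inr (negSimpleRoot A i))) := by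
  simp only [cartanMap, Fintype.linearCombination_apply, sum_lie, smul_lie, lie_h_negSimple,
    smul_neg, smul_smul, Finset.sum_neg_distrib, Finset.sum_smul, mul_comm]

theorem lie_principalY_cartanMap (w : Fin n → k) :
    ⁅B.principalY, B.cartanMap w⁆ =
      B.negSimpleMap (principalEnd A (fun i ↦ (twoRhoCheck A i : k)) w) := by
  rw [principalY, negSimpleMap, Fintype.linearCombination_apply, sum_lie]
  refine Finset.sum_congr rfl fun i _ ↦ ?_
  rw [principalEnd_apply, ← Int.cast_smul_eq_zsmul k, smul_lie, ← lie_skew,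
    lie_cartanMap_negSimple, neg_neg, smul_smul]

/-- `B` makes `g` a principally graded module over the principal `sl₂`, acting through `φ`, with
exponents `E`, and the characteristic of `k` distinguishes the degrees that occur; the exponent `m`
has the eigenvector `u m` on the Cartan subalgebra. -/
structure IsPrincipallyGraded (φ : LieAlgebra.SpecialLinear.sl (Fin 2) k →ₗ⁅k⁆ g) (E : Finset ℕ)
    (u : ℕ → Fin n → k) : Prop
    extends IsPrincipalGrading B.degreeSpace B.principalH B.principalX B.principalY B.cartanMap
      (principalEnd A fun i ↦ (twoRhoCheck A i : k)) E u where
  isPrincipal : B.IsPrincipal φ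
  two_ne_zero : (2 : k) ≠ 0
  natCast_injOn : ∀ m ∈ E, Set.InjOn (Nat.cast : ℕ → k) (Set.Iic m)

variable {B} {φ : LieAlgebra.SpecialLinear.sl (Fin 2) k →ₗ⁅k⁆ g} {u : ℕ → Fin n → k}

theorem isPrincipallyGraded [NeZero n] (hφ : B.IsPrincipal φ) (h2 : (2 : k) ≠ 0)
    (hinj : ∀ m ∈ E, Set.InjOn (Nat.cast : ℕ → k) (Set.Iic m)) (hA : HasExponentHeights A E)
    (hN : HasExponents (principalEnd A fun i ↦ (twoRhoCheck A i : k)) E u) :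
    B.IsPrincipallyGraded φ E u where
  toIsSl2Grading := isSl2Grading hφ h2 hA
  toHasExponents := hN
  injective := B.cartanMap_injective
  range_eq := B.range_cartanMap.trans (B.cartanSpace_eq_degreeSpace hA)
  lie_f_lie_e w := by
    have hw : B.cartanMap w ∈ B.degreeSpace 0 := by
      rw [← B.cartanSpace_eq_degreeSpace hA, ← range_cartanMap]
      exact LinearMap.mem_range_self _ w
    have hcomm := (isSl2Grading hφ h2 hA).lie_e_lie_f hw
    rwa [lie_principalY_cartanMap, lie_principalX_negSimpleMap B hA, Int.cast_zero, mul_zero,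
      zero_smul, add_zero, eq_comm] at hcomm
  finrank_le := B.finrank_degreeSpace_le hA (by simpa using hN.finrank_eq)
  isPrincipal := hφ
  two_ne_zero := h2
  natCast_injOn := hinj

namespace IsPrincipallyGraded

variable [FiniteDimensional k g] {m : ℕ} {p : g}

theorem centralizerEigenspace_eq (hG : B.IsPrincipallyGraded φ E u) (hm : m ∈ E)
    (hp : p ∈ B.degreeSpace m) (P : hG.toIsSl2Triple.HasPrimitiveVectorWith p (2 * m : k)) :
    B.centralizerEigenspace m = k ∙ p := by
  rw [← hG.ker_toEnd_e_inf_eq_span hm hp P]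
  refine le_antisymm (fun v hv ↦ ⟨hv.1, ?_⟩) fun v hv ↦ ⟨hv.1, by simpa using hG.lie_h hv.2⟩
  exact hG.mem_of_lie_e_eq_zero hG.natCast_injOn hG.two_ne_zero hm hv.1 hv.2

theorem exists_primitive_summand_eq (hG : B.IsPrincipallyGraded φ E u) (hm : m ∈ E) :
    ∃ p ∈ B.degreeSpace m, hG.toIsSl2Triple.HasPrimitiveVectorWith p (2 * m : k) ∧
      B.summand φ m = lowerSpan k B.principalY p := by
  obtain ⟨p, hp, P⟩ := hG.exists_primitive hm
  have hc := hG.centralizerEigenspace_eq hm hp P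
  refine ⟨p, hp, P, le_antisymm (sInf_le ⟨isSl2Stable_lowerSpan hG.isPrincipal P, ?_⟩) ?_⟩
  · rw [hc, span_singleton_le_iff_mem]
    exact mem_lowerSpan_self _ p
  · refine le_sInf fun V ⟨hV, hle⟩ ↦
      lowerSpan_le ?_ fun v hv ↦ ((isSl2Stable_iff hG.isPrincipal).mp hV v hv).2.2
    rwa [hc, span_singleton_le_iff_mem] at hle

theorem finrank_centralizerEigenspace (hG : B.IsPrincipallyGraded φ E u) (hm : m ∈ E) :
    finrank k (B.centralizerEigenspace m) = 1 := by
  obtain ⟨p, hp, P⟩ := hG.exists_primitive hm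
  rw [hG.centralizerEigenspace_eq hm hp P, finrank_span_singleton P.ne_zero]

theorem isSymPower_summand (hG : B.IsPrincipallyGraded φ E u) (hm : m ∈ E)
    (hfac : ((2 * m).factorial : k) ≠ 0) : IsSymPower φ (2 * m) (B.summand φ m) := by
  obtain ⟨p, hp, P, hs⟩ := hG.exists_primitive_summand_eq hm
  exact hs ▸ hG.isSymPower_lowerSpan hG.isPrincipal hp P hfac

theorem eq_summand_of_isSymPower (hG : B.IsPrincipallyGraded φ E u) (hm : m ∈ E)
    (hfac : ((2 * m).factorial : k) ≠ 0) {V : Submodule k g} (hV : IsSymPower φ (2 * m) V) :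
    V = B.summand φ m := by
  obtain ⟨p, hp, P, hs⟩ := hG.exists_primitive_summand_eq hm
  exact hs ▸ hG.eq_lowerSpan_of_isSymPower hG.isPrincipal hG.natCast_injOn hG.two_ne_zero hm hp P
    hfac hV

theorem exists_isCompl_summand (hG : B.IsPrincipallyGraded φ E u)
    (hinj : Set.InjOn (fun m : ℕ ↦ (m : k) * (m + 1)) E) (hm : m ∈ E) :
    ∃ V, IsSl2Stable φ V ∧ IsCompl (B.summand φ m) V := by
  choose! p hp P hs using fun m (hm : m ∈ E) ↦ hG.exists_primitive_summand_eq hm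
  refine ⟨_, fun s ↦ lie_mem_iSup₂ fun a ha ↦ ?_,
    hs m hm ▸ hG.isCompl_lowerSpan hG.two_ne_zero hinj hp P hm⟩
  exact isSl2Stable_lowerSpan hG.isPrincipal (P a (Finset.mem_of_mem_erase ha)) s

theorem summand_inf_cartanSpace (hG : B.IsPrincipallyGraded φ E u) (hm : m ∈ E) :
    B.summand φ m ⊓ B.cartanSpace = k ∙ B.cartanMap (u m) := by
  obtain ⟨p, hp, P, hs⟩ := hG.exists_primitive_summand_eq hm
  rw [hs, ← range_cartanMap, hG.range_eq, hG.lowerSpan_inf_zero hm hp P]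

theorem summand_inf_negSimpleSpace (hG : B.IsPrincipallyGraded φ E u) (hm : m ∈ E) :
    B.summand φ m ⊓ B.negSimpleSpace = k ∙ B.negSimpleMap (u m) := by
  obtain ⟨p, hp, P, hs⟩ := hG.exists_primitive_summand_eq hm
  have hinf := hG.lowerSpan_inf_neg_one hm hp P
  rw [lie_principalY_cartanMap, hG.apply_eigenvector hm, map_smul,
    span_singleton_smul_eq (hG.casimir_ne_zero hm).isUnit] at hinf
  have hle : (k ∙ B.negSimpleMap (u m)) ≤ B.negSimpleSpace := by
    rw [span_singleton_le_iff_mem, ← range_negSimpleMap]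
    exact LinearMap.mem_range_self _ _
  rw [hs, ← inf_eq_left.mpr hle, ← hinf, inf_assoc,
    inf_eq_right.mpr B.negSimpleSpace_le_degreeSpace]

theorem projNegRootNonzero_iff (hG : B.IsPrincipallyGraded φ E u) (hm : m ∈ E) (i : Fin n) :
    B.ProjNegRootNonzero (B.summand φ m ⊓ B.negSimpleSpace) i ↔ u m i ≠ 0 := by
  rw [hG.summand_inf_negSimpleSpace hm, ProjNegRootNonzero]
  refine ⟨fun ⟨v, hv, hvi⟩ h0 ↦ ?_, fun hu ↦ ⟨_, mem_span_singleton_self _, ?_⟩⟩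
  · obtain ⟨a, rfl⟩ := mem_span_singleton.mp hv
    rw [map_smul, Finsupp.smul_apply, repr_negSimpleMap, h0, smul_zero] at hvi
    exact hvi rfl
  · rwa [repr_negSimpleMap]

theorem finrank_summand_inf_negSimpleSpace (hG : B.IsPrincipallyGraded φ E u) (hm : m ∈ E) :
    finrank k ↥(B.summand φ m ⊓ B.negSimpleSpace) = 1 := by
  rw [hG.summand_inf_negSimpleSpace hm, finrank_span_singleton]
  intro h0
  refine hG.eigenvector_ne_zero hm (funext fun i ↦ ?_)
  rw [← B.repr_negSimpleMap (u m), h0, map_zero, Finsupp.zero_apply, Pi.zero_apply]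

theorem projCorootNonzero (hG : B.IsPrincipallyGraded φ E u) (hm : m ∈ E)
    {i : Fin n} (hi : A i i = 2) (hu : u m i ≠ 0) :
    B.ProjCorootNonzero (B.summand φ m ⊓ B.cartanSpace) i := by
  set a : k := ∑ j, A i j * u m j with ha
  have ha0 : a ≠ 0 := by
    have heig := congrFun (hG.apply_eigenvector hm) i
    rw [principalEnd_apply, Pi.smul_apply, smul_eq_mul] at heig
    exact right_ne_zero_of_mul (heig ▸ mul_ne_zero (hG.casimir_ne_zero hm) hu)
  rw [hG.summand_inf_cartanSpace hm]
  have hmem : B.cartanMap (u m) ∈ B.cartanSpace :=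
    B.range_cartanMap ▸ LinearMap.mem_range_self _ _
  refine ⟨_, mem_span_singleton_self _, B.cartanMap (u m) - (a / 2) • B.basis (.inl i),
    sub_mem hmem (smul_mem _ _ (subset_span ⟨i, rfl⟩)), a / 2, ?_, div_ne_zero ha0 hG.two_ne_zero,
    (sub_add_cancel _ _).symm⟩
  rw [sub_lie, smul_lie, lie_h_simple, lie_cartanMap_simple, hi, smul_smul, ← sub_smul, ← ha]
  push_cast
  rw [div_mul_cancel₀ _ hG.two_ne_zero, sub_self, zero_smul]

end IsPrincipallyGraded

end ChevalleyBasis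

end

/-- The vector of the last `n` decimal digits of `c`, with the units digit at index `0`. -/
def digitVector (n c : ℕ) : Fin n → ℤ := fun j ↦ (c / 10 ^ (j : ℕ) % 10 : ℕ)

/-- The pair of a root and its coroot whose coefficients are the decimal digits of the two entries
of `c`. -/
def digitPair (n : ℕ) (c : ℕ × ℕ) : (Fin n → ℤ) × (Fin n → ℤ) :=
  (digitVector n c.1, digitVector n c.2)

/-- The `i`-th simple reflection in terms of the codes of `digitPair`. -/
def reflectCode {n : ℕ} (A : Matrix (Fin n) (Fin n) ℤ) (i : Fin n) (c : ℕ × ℕ) : ℕ × ℕ :=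
  ((c.1 - pairSimpleCoroot A (digitVector n c.1) i * 10 ^ (i : ℕ)).toNat,
    (c.2 - pairSimpleRoot A i (digitVector n c.2) * 10 ^ (i : ℕ)).toNat)

namespace ExceptionalType

/-- The positive roots of types `E₆`, `E₇` and `E₈` and their coroots, in the coding of `digitPair`:
those of `E_n` are the roots of `E₈` that involve only the first `n` simple roots, and as the type
is simply laced, a root and its coroot have the same coefficients. -/
def rootCodesE (n : ℕ) : List (ℕ × ℕ) :=
  ([10000000, 1000000, 100000, 10000, 1000, 100, 10, 1, 11000000, 1100000,
   110000, 11000, 1100, 1010, 101, 11100000, 1110000, 111000, 11100, 11010,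
   1110, 1101, 11110000, 1111000, 111100, 111010, 11110, 11101, 1111,
   11111000, 1111100, 1111010, 111110, 12110, 111101, 11111, 11111100, 11111010,
   1111110, 112110, 1111101, 111111, 12111, 11111110, 1112110, 122110, 11111101,
   1111111, 112111, 12211, 11112110, 1122110, 11111111, 1112111, 122111, 112211,
   11122110, 1222110, 11112111, 1122111, 1112211, 122211, 11222110, 11122111,
   1222111, 11112211, 1122211, 123211, 12222110, 11222111, 11122211, 1222211,
   1123211, 123221, 12222111, 11222211, 11123211, 1223211, 1123221, 12222211,
   11223211, 1233211, 11123221, 1223221, 12223211, 11233211, 11223221, 1233221,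
   12233211, 12223221, 11233221, 1234221, 12333211, 12233221, 11234221, 1234321,
   12333221, 12234221, 11234321, 1234322, 12334221, 12234321, 11234322, 12344221,
   12334321, 12234322, 12344321, 12334322, 12345321, 12344322, 12345331, 12345322,
   12345422, 12345332, 12345432, 12346432, 12356432, 12456432, 13456432, 23456432]).filter
      (· < 10 ^ n) |>.map fun c ↦ (c, c)

/-- The positive roots and their coroots, in the coding of `digitPair`. -/
def rootCodes : ExceptionalType → List (ℕ × ℕ)
  | G₂ =>
    [(10, 10), (1, 1), (11, 13), (21, 23), (31, 11), (32, 12)]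
  | F₄ =>
    [(1000, 1000), (100, 100), (10, 10), (1, 1), (1100, 1100), (110, 120), (11, 11), (1110, 1120),
     (210, 110), (111, 122), (1210, 1220), (1111, 1122), (211, 111), (2210, 1110), (1211, 1222),
     (221, 121), (2211, 1111), (1221, 1242), (2221, 1121), (1321, 1342), (2321, 2342),
     (2421, 1221), (2431, 1231), (2432, 1232)]
  | E₆ => rootCodesE 6
  | E₇ => rootCodesE 7
  | E₈ => rootCodesE 8

theorem cartan_diag (t : ExceptionalType) (i : Fin t.rank) : t.cartan i i = 2 := by
  revert i
  cases t <;> decide +kernel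

theorem simple_mem_rootCodes (t : ExceptionalType) (i : Fin t.rank) :
    (Pi.single i 1, Pi.single i 1) ∈ t.rootCodes.map (digitPair t.rank) := by
  revert i
  cases t <;> decide +kernel

set_option maxRecDepth 100000 in
theorem reflectCode_mem_rootCodes (t : ExceptionalType) : ∀ c ∈ t.rootCodes, ∀ i,
    digitPair t.rank c = (Pi.single i 1, Pi.single i 1) ∨
      reflectCode t.cartan i c ∈ t.rootCodes ∧
      digitPair t.rank (reflectCode t.cartan i c) =
        reflectPair t.cartan i (digitPair t.rank c) := by
  cases t <;> decide +kernel

theorem sum_rootCodes_pos (t : ExceptionalType) :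
    ∀ c ∈ t.rootCodes, 0 < ∑ j, (digitPair t.rank c).1 j := by
  cases t <;> decide +kernel

set_option maxRecDepth 100000 in
theorem countP_rootCodes_le (t : ExceptionalType) : ∀ c ∈ t.rootCodes,
    t.rootCodes.countP (fun d ↦ ∑ j, (digitPair t.rank d).1 j = ∑ j, (digitPair t.rank c).1 j) ≤
      (t.exponents.filter ((∑ j, (digitPair t.rank c).1 j).toNat ≤ ·)).card := by
  cases t <;> decide +kernel

theorem isPositiveSystem (t : ExceptionalType) :
    IsPositiveSystem t.cartan (t.rootCodes.map (digitPair t.rank)) where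
  diag := t.cartan_diag
  simple_mem := t.simple_mem_rootCodes
  reflect_mem := List.forall_mem_map.mpr fun c hc i ↦
    (t.reflectCode_mem_rootCodes c hc i).imp_right fun ⟨hmem, heq⟩ ↦
      heq ▸ List.mem_map_of_mem hmem

theorem hasExponentHeights (t : ExceptionalType) : HasExponentHeights t.cartan t.exponents :=
  t.isPositiveSystem.hasExponentHeights (List.forall_mem_map.mpr t.sum_rootCodes_pos) <|
    List.forall_mem_map.mpr fun c hc ↦ by
      rw [List.countP_map]
      exact t.countP_rootCodes_le c hc

end ExceptionalType

section CharP

variable {k : Type*} [CommRing k] (ℓ : ℕ) [CharP k ℓ]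

theorem natCast_injOn_Iio {n : ℕ} (hℓ : ℓ = 0 ∨ n ≤ ℓ) :
    Set.InjOn (Nat.cast : ℕ → k) (Set.Iio n) := by
  obtain rfl | hn := hℓ
  · have := CharP.charP_to_charZero k
    exact Nat.cast_injective.injOn
  · exact (CharP.natCast_injOn_Iio k ℓ).mono (Set.Iio_subset_Iio hn)

variable [IsDomain k]

theorem intCast_ne_zero_of_natAbs_mem_factoredNumbers {S : Finset ℕ} (hℓ : ℓ = 0 ∨ ℓ ∉ S) {a : ℤ}
    (ha : a.natAbs ∈ Nat.factoredNumbers S) : (a : k) ≠ 0 := by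
  rw [Ne, CharP.intCast_eq_zero_iff k ℓ, ← Int.natAbs_dvd_natAbs, Int.natAbs_natCast]
  intro hdvd
  obtain hprime | rfl := CharP.char_is_prime_or_zero k ℓ
  · exact hℓ.resolve_left hprime.ne_zero (Nat.mem_factoredNumbers'.mp ha ℓ hprime hdvd)
  · exact Nat.ne_zero_of_mem_factoredNumbers ha (zero_dvd_iff.mp hdvd)

theorem intCast_ne_zero_of_natAbs_mem_smoothNumbers {n : ℕ} (hℓ : ℓ = 0 ∨ n ≤ ℓ) {a : ℤ}
    (ha : a.natAbs ∈ Nat.smoothNumbers n) : (a : k) ≠ 0 :=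
  intCast_ne_zero_of_natAbs_mem_factoredNumbers ℓ
    (hℓ.imp_right fun h ↦ by simpa using h) (Nat.smoothNumbers_eq_factoredNumbers n ▸ ha)

theorem factorial_natCast_ne_zero {n : ℕ} (hℓ : ℓ = 0 ∨ n < ℓ) : (n.factorial : k) ≠ 0 := by
  rw [← Int.cast_natCast]
  refine intCast_ne_zero_of_natAbs_mem_smoothNumbers ℓ (n := n + 1) hℓ ?_
  exact Nat.mem_smoothNumbers'.mpr fun p hp hdvd ↦ Nat.lt_succ_of_le (hp.dvd_factorial.mp hdvd)

theorem injOn_mul_add_one {n : ℕ} (hℓ : ℓ = 0 ∨ 2 * n - 1 ≤ ℓ) :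
    Set.InjOn (fun m : ℕ ↦ (m : k) * (m + 1)) (Set.Iio n) := by
  intro a ha b hb hab
  simp only [Set.mem_Iio] at ha hb
  have hinj := natCast_injOn_Iio (k := k) ℓ hℓ
  have hfactor : ((a : k) - b) * ((a + b + 1 : ℕ) : k) = 0 := by
    push_cast
    linear_combination hab
  by_contra hne
  obtain hsub | hsum := mul_eq_zero.mp hfactor
  · exact hne (hinj (by grind) (by grind) (sub_eq_zero.mp hsub))
  · have := hinj (x₁ := a + b + 1) (x₂ := 0) (by grind) (by grind) (hsum.trans Nat.cast_zero.symm)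
    omega

end CharP

section Eigenspaces

open Module Polynomial

theorem aeval_prod_X_sub_C_eq_zero {R ι : Type*} [CommRing R] [IsDomain R] [Fintype ι]
    [DecidableEq ι] {M : Matrix ι ι R} {μ : ι → R} (hμ : Function.Injective μ) {v : ι → ι → R}
    (hv : ∀ i, v i ≠ 0) (hM : ∀ i, M.mulVec (v i) = μ i • v i) :
    aeval M (∏ i, (X - C (μ i))) = 0 := by
  have hli : LinearIndependent R v :=
    End.eigenvectors_linearIndependent' (Matrix.toLin' M) μ hμ v fun i ↦
      End.hasEigenvector_iff.mpr ⟨End.mem_eigenspace_iff.mpr (hM i), hv i⟩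
  have hdet : (Matrix.of v).det ≠ 0 := by
    rw [Ne, ← Matrix.exists_vecMul_eq_zero_iff]
    rintro ⟨w, hw, hw0⟩
    refine hw (funext (Fintype.linearIndependent_iff.mp hli w ?_))
    rwa [Matrix.vecMul_eq_sum] at hw0
  have hker (i : ι) : (aeval M (∏ i, (X - C (μ i)))).mulVec (v i) = 0 := by
    rw [← Finset.prod_erase_mul _ _ (Finset.mem_univ i), map_mul, ← Matrix.mulVec_mulVec, map_sub,
      aeval_X, aeval_C, Matrix.sub_mulVec, hM, Algebra.algebraMap_eq_smul_one, Matrix.smul_mulVec,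
      Matrix.one_mulVec, sub_self, Matrix.mulVec_zero]
  funext r
  exact Matrix.eq_zero_of_mulVec_eq_zero hdet <| funext fun i ↦
    (dotProduct_comm _ _).trans (congrFun (hker i) r)

theorem aeval_casimirPoly_eq_zero {n : ℕ} {M : Matrix (Fin n) (Fin n) ℤ} {E : Finset ℕ}
    (hn : n = E.card) {v : ℕ → Fin n → ℤ} (hv : ∀ m ∈ E, v m ≠ 0)
    (hM : ∀ m ∈ E, M.mulVec (v m) = ((m : ℤ) * (m + 1)) • v m) :
    aeval M (casimirPoly ℤ E) = 0 := by
  let e : Fin n ≃ E := (finCongr hn).trans E.equivFin.symm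
  have hmono : StrictMono fun m : ℕ ↦ (m : ℤ) * (m + 1) := fun a b hab ↦ by
    have : (a : ℤ) < b := by exact_mod_cast hab
    nlinarith
  have hμ : Function.Injective fun i ↦ ((e i : ℕ) : ℤ) * ((e i : ℕ) + 1) :=
    hmono.injective.comp (Subtype.val_injective.comp e.injective)
  have hprod : casimirPoly ℤ E = ∏ i, (X - C (((e i : ℕ) : ℤ) * ((e i : ℕ) + 1))) := by
    rw [casimirPoly, ← Finset.prod_coe_sort, ← e.prod_comp]
  rw [hprod]
  exact aeval_prod_X_sub_C_eq_zero hμ (v := fun i ↦ v (e i)) (fun i ↦ hv _ (e i).2)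
    fun i ↦ hM _ (e i).2

theorem aeval_toLin'_map_intCast {ι R : Type*} [Fintype ι] [DecidableEq ι] [CommRing R]
    (M : Matrix ι ι ℤ) (p : ℤ[X]) :
    aeval (Matrix.toLin' (M.map ((↑) : ℤ → R))) (p.map (Int.castRingHom R)) =
      Matrix.toLin' ((aeval M p).map (↑)) := by
  have hmap : (Int.castRingHom R).mapMatrix (aeval M p) =
      aeval ((Int.castRingHom R).mapMatrix M) (p.map (Int.castRingHom R)) :=
    Polynomial.map_aeval_eq_aeval_map (RingHom.ext_int _ _) p M
  exact (Polynomial.aeval_algHom_apply Matrix.toLinAlgEquiv'.toAlgHom _ _).trans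
    (congrArg Matrix.toLin' hmap.symm)

theorem eq_zero_of_mulVec_eq_zero_of_pivot {ι κ R : Type*} [Fintype ι] [Ring R] [NoZeroDivisors R]
    {M : Matrix κ ι R} {l : ι} (row : ι → κ) (rank : ι → ℕ) (hpivot : ∀ j ≠ l, M (row j) j ≠ 0)
    (hzero : ∀ j ≠ l, ∀ j' ≠ j, rank j ≤ rank j' → M (row j) j' = 0) {x : ι → R}
    (hx : M.mulVec x = 0) (hl : x l = 0) : x = 0 := by
  funext j
  induction hr : rank j using Nat.strong_induction_on generalizing j with
  | _ r ih =>
    obtain rfl | hj := eq_or_ne j l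
    · exact hl
    have hrow : M (row j) j * x j = 0 := by
      refine Eq.trans (Eq.symm (Fintype.sum_eq_single j fun j' hj' ↦ ?_)) (congrFun hx (row j))
      obtain hlt | hle := lt_or_ge (rank j') (rank j)
      · exact mul_eq_zero_of_right _ (ih _ (hr ▸ hlt) j' rfl)
      · exact mul_eq_zero_of_left (hzero j hj j' hj' hle) _
    exact (mul_eq_zero.mp hrow).resolve_left (hpivot j hj)

theorem eigenspace_eq_span_singleton {k V : Type*} [Field k] [AddCommGroup V] [Module k V]
    {f : End k V} {μ : k} {u : V} (hu : f u = μ • u) (ξ : Dual k V) (hξu : ξ u ≠ 0)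
    (hξ : ∀ x, f x = μ • x → ξ x = 0 → x = 0) : f.eigenspace μ = k ∙ u := by
  refine le_antisymm (fun x hx ↦ ?_) ?_
  · rw [End.mem_eigenspace_iff] at hx
    refine Submodule.mem_span_singleton.mpr ⟨ξ x / ξ u, (sub_eq_zero.mp (hξ _ ?_ ?_)).symm⟩
    · rw [map_sub, map_smul, hx, hu, smul_sub, smul_comm μ]
    · rw [map_sub, map_smul, smul_eq_mul, div_mul_cancel₀ _ hξu, sub_self]
  · rwa [Submodule.span_singleton_le_iff_mem, End.mem_eigenspace_iff]

end Eigenspaces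

namespace ExceptionalType

/-- The coefficients of `2ρ^∨` in the basis of simple coroots. -/
def twoRhoCoeff : (t : ExceptionalType) → Fin t.rank → ℤ
  | G₂ => ![10, 6]
  | F₄ => ![22, 42, 30, 16]
  | E₆ => ![16, 22, 30, 42, 30, 16]
  | E₇ => ![34, 49, 66, 96, 75, 52, 27]
  | E₈ => ![92, 136, 182, 270, 220, 168, 114, 58]

/-- For an exponent `m`, the coordinates in the simple coroots of an eigenvector of
`principalMatrix` for the eigenvalue `m (m + 1)`, scaled to coprime entries; it spans the
intersection of `V_m` with the Cartan subalgebra. -/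
def eigenCoeff : (t : ExceptionalType) → ℕ → Fin t.rank → ℤ
  | G₂, 1 => ![5, 3]
  | G₂, 5 => ![-3, 1]
  | F₄, 1 => ![11, 21, 15, 8]
  | F₄, 5 => ![-11, -7, 1, 8]
  | F₄, 7 => ![22, -12, -15, 10]
  | F₄, 11 => ![-14, 56, -25, 4]
  | E₆, 1 => ![8, 11, 15, 21, 15, 8]
  | E₆, 4 => ![-4, 0, -3, 0, 3, 4]
  | E₆, 5 => ![8, -11, 1, -7, 1, 8]
  | E₆, 7 => ![10, 22, -15, -12, -15, 10]
  | E₆, 8 => ![-2, 0, 5, 0, -5, 2]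
  | E₆, 11 => ![4, -14, -25, 56, -25, 4]
  | E₇, 1 => ![34, 49, 66, 96, 75, 52, 27]
  | E₇, 5 => ![-374, -196, -418, -272, 155, 520, 585]
  | E₇, 7 => ![748, -518, 264, -444, -375, -26, 351]
  | E₇, 9 => ![-34, 294, 22, 48, -265, -260, 195]
  | E₇, 11 => ![-136, -196, 256, 136, 25, -130, 45]
  | E₇, 13 => ![187, -168, -627, 288, 825, -640, 135]
  | E₇, 17 => ![-143, 588, 1001, -2496, 1375, -364, 39]
  | E₈, 1 => ![46, 68, 91, 135, 110, 84, 57, 29]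
  | E₈, 7 => ![-299, -255, -416, -405, -55, 309, 570, 551]
  | E₈, 11 => ![5635, -1530, 3185, -1575, -4035, -4074, -912, 3306]
  | E₈, 13 => ![-690, 1020, -15, 675, -110, -804, -627, 551]
  | E₈, 17 => ![-4186, -23820, 5551, 5955, 23430, 8316, -21945, 6699]
  | E₈, 19 => ![299, 306, -637, -243, 187, 294, -264, 58]
  | E₈, 23 => ![-1911, 2907, 7644, -5985, -10285, 11221, -4142, 551]
  | E₈, 29 => ![7774, -34884, -57967, 153387, -94622, 31556, -5681, 437]
  | _, _ => 0

/-- The matrix of `principalEnd` for the coefficients of `2ρ^∨`. -/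
def principalMatrix (t : ExceptionalType) : Matrix (Fin t.rank) (Fin t.rank) ℤ :=
  Matrix.diagonal t.twoRhoCoeff * t.cartan

/-- The node at the end of the longest branch of the Dynkin diagram. -/
def lastNode (t : ExceptionalType) : Fin t.rank :=
  ⟨t.rank - 1, by cases t <;> decide⟩

/-- A node other than `lastNode` occurs in the `pivotRow` equation of the system
`principalMatrix * x = m (m + 1) * x` together with nodes of smaller `pivotRank` only, so that the
system can be solved backwards from `lastNode`. The value at `lastNode` is irrelevant. -/
def pivotRow : (t : ExceptionalType) → Fin t.rank → Fin t.rank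
  | G₂ => (![1, 0] : Fin 2 → Fin 2)
  | F₄ => (![1, 2, 3, 0] : Fin 4 → Fin 4)
  | E₆ => (![2, 1, 3, 4, 5, 0] : Fin 6 → Fin 6)
  | E₇ => (![2, 1, 3, 4, 5, 6, 0] : Fin 7 → Fin 7)
  | E₈ => (![2, 1, 3, 4, 5, 6, 7, 0] : Fin 8 → Fin 8)

/-- The position of a node in the order of elimination of `pivotRow`. -/
def pivotRank : (t : ExceptionalType) → Fin t.rank → ℕ
  | G₂ => ![1, 0]
  | F₄ => ![3, 2, 1, 0]
  | E₆ => ![5, 3, 4, 2, 1, 0]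
  | E₇ => ![6, 4, 5, 3, 2, 1, 0]
  | E₈ => ![7, 5, 6, 4, 3, 2, 1, 0]

instance (t : ExceptionalType) : NeZero t.rank :=
  ⟨by cases t <;> decide⟩

theorem rank_eq_card_exponents (t : ExceptionalType) : t.rank = t.exponents.card := by
  cases t <;> rfl

theorem two_lt_coxeterNumber (t : ExceptionalType) : 2 < t.coxeterNumber := by
  cases t <;> decide

theorem pos_of_mem_exponents (t : ExceptionalType) : ∀ m ∈ t.exponents, 0 < m := by
  cases t <;> decide

theorem lt_coxeterNumber_of_mem_exponents (t : ExceptionalType) :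
    ∀ m ∈ t.exponents, m < t.coxeterNumber := by
  cases t <;> decide

theorem natAbs_det_cartan_mem_smoothNumbers (t : ExceptionalType) :
    t.cartan.det.natAbs ∈ Nat.smoothNumbers t.coxeterNumber := by
  cases t
  · exact CartanMatrix.G₂_det ▸ by decide +kernel
  · exact CartanMatrix.F₄_det ▸ by decide +kernel
  · exact CartanMatrix.E₆_det ▸ by decide +kernel
  · exact CartanMatrix.E₇_det ▸ by decide +kernel
  · exact CartanMatrix.E₈_det ▸ by decide +kernel

theorem cartan_mulVec_twoRhoCoeff (t : ExceptionalType) : t.cartan.mulVec t.twoRhoCoeff = 2 := by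
  cases t <;> decide +kernel

theorem principalMatrix_mulVec_eigenCoeff (t : ExceptionalType) : ∀ m ∈ t.exponents,
    t.principalMatrix.mulVec (t.eigenCoeff m) = ((m : ℤ) * (m + 1)) • t.eigenCoeff m := by
  cases t <;> decide +kernel

theorem natAbs_eigenCoeff_lastNode_mem_smoothNumbers (t : ExceptionalType) : ∀ m ∈ t.exponents,
    (t.eigenCoeff m t.lastNode).natAbs ∈ Nat.smoothNumbers t.coxeterNumber := by
  cases t <;> decide +kernel

theorem natAbs_casimir_sub_mem_smoothNumbers (t : ExceptionalType) :
    ∀ m ∈ t.exponents, ∀ a < m, a ∉ t.exponents →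
      ((a : ℤ) * (a + 1) - m * (m + 1)).natAbs ∈ Nat.smoothNumbers t.coxeterNumber := by
  cases t <;> decide +kernel

theorem natAbs_pivot_mem_smoothNumbers (t : ExceptionalType) :
    ∀ m ∈ t.exponents, ∀ j ≠ t.lastNode,
      ((t.principalMatrix - ((m : ℤ) * (m + 1)) • 1) (t.pivotRow j) j).natAbs ∈
        Nat.smoothNumbers t.coxeterNumber := by
  cases t <;> decide +kernel

theorem sub_smul_one_pivotRow_eq_zero (t : ExceptionalType) :
    ∀ m ∈ t.exponents, ∀ j ≠ t.lastNode, ∀ j' ≠ j, t.pivotRank j ≤ t.pivotRank j' →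
      (t.principalMatrix - ((m : ℤ) * (m + 1)) • 1) (t.pivotRow j) j' = 0 := by
  cases t <;> decide +kernel

theorem natAbs_eigenCoeff_mem_factoredNumbers (t : ExceptionalType) : ∀ m ∈ t.exponents, ∀ i,
    t.eigenCoeff m i ≠ 0 → (t.eigenCoeff m i).natAbs ∈ Nat.factoredNumbers t.badPrimes := by
  cases t <;> decide +kernel

theorem exists_dvd_eigenCoeff (t : ExceptionalType) : ∀ p ∈ t.badPrimes, t.coxeterNumber ≤ p →
    ∃ m ∈ t.exponents, ∃ i, (p : ℤ) ∣ t.eigenCoeff m i := by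
  cases t <;> decide +kernel

theorem eigenCoeff_ne_zero (t : ExceptionalType) (ht : t ≠ .E₆) :
    ∀ m ∈ t.exponents, ∀ i, t.eigenCoeff m i ≠ 0 := by
  cases t <;> first | exact absurd rfl ht | decide +kernel

theorem eigenCoeff_E₆_ne_zero : ∀ m ∈ exponents .E₆, ∀ i : Fin (rank .E₆),
    (m ≠ 4 ∧ m ≠ 8) ∨ (i ≠ 1 ∧ i ≠ 3) → eigenCoeff .E₆ m i ≠ 0 := by
  decide +kernel

theorem mem_badPrimes_of_lt (t : ExceptionalType) :
    ∀ p < t.coxeterNumber, p.Prime → p ∈ t.badPrimes := by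
  cases t <;> decide +kernel

end ExceptionalType

namespace ExceptionalType

open Module

section CharP

variable (t : ExceptionalType) {k : Type*} [Field k] (ℓ : ℕ) [CharP k ℓ]

include k in
theorem coxeterNumber_le_of_notMem_badPrimes (hℓ : ℓ ∉ t.badPrimes) :
    ℓ = 0 ∨ t.coxeterNumber ≤ ℓ :=
  (CharP.char_is_prime_or_zero k ℓ).symm.imp_right fun hprime ↦
    not_lt.mp fun hlt ↦ hℓ (t.mem_badPrimes_of_lt ℓ hlt hprime)

theorem intCast_eigenCoeff_ne_zero (hℓ : ℓ ∉ t.badPrimes) {m : ℕ} (hm : m ∈ t.exponents)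
    {i : Fin t.rank} (hi : t.eigenCoeff m i ≠ 0) : (t.eigenCoeff m i : k) ≠ 0 :=
  intCast_ne_zero_of_natAbs_mem_factoredNumbers ℓ (.inr hℓ)
    (t.natAbs_eigenCoeff_mem_factoredNumbers m hm i hi)

theorem factorial_two_mul_ne_zero (hℓ : ℓ = 0 ∨ 2 * t.coxeterNumber - 1 ≤ ℓ) {m : ℕ}
    (hm : m ∈ t.exponents) : ((2 * m).factorial : k) ≠ 0 :=
  factorial_natCast_ne_zero ℓ <| hℓ.imp_right fun h ↦ by
    have := t.lt_coxeterNumber_of_mem_exponents m hm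
    omega

theorem injOn_mul_add_one_exponents (hℓ : ℓ = 0 ∨ 2 * t.coxeterNumber - 1 ≤ ℓ) :
    Set.InjOn (fun m : ℕ ↦ (m : k) * (m + 1)) t.exponents :=
  (injOn_mul_add_one ℓ hℓ).mono t.lt_coxeterNumber_of_mem_exponents

variable {t} {ℓ} (hℓ : ℓ = 0 ∨ t.coxeterNumber ≤ ℓ)

include hℓ

theorem two_ne_zero_of_coxeterNumber_le : (2 : k) ≠ 0 := by
  exact_mod_cast factorial_natCast_ne_zero (k := k) (n := 2) ℓ
    (hℓ.imp_right t.two_lt_coxeterNumber.trans_le)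

theorem natCast_injOn_Iic_exponent (m : ℕ) (hm : m ∈ t.exponents) :
    Set.InjOn (Nat.cast : ℕ → k) (Set.Iic m) :=
  (natCast_injOn_Iio ℓ hℓ).mono (Set.Iic_subset_Iio.mpr (t.lt_coxeterNumber_of_mem_exponents m hm))

theorem eigenspace_principalMatrix_eq_span {m : ℕ} (hm : m ∈ t.exponents) :
    End.eigenspace (Matrix.toLin' (t.principalMatrix.map ((↑) : ℤ → k))) (m * (m + 1)) =
      k ∙ fun i ↦ (t.eigenCoeff m i : k) := by
  have hshift : t.principalMatrix.map ((↑) : ℤ → k) - ((m : k) * (m + 1)) • 1 =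
      (t.principalMatrix - ((m : ℤ) * (m + 1)) • 1).map (↑) := by
    rw [Matrix.map_sub _ Int.cast_sub, Matrix.map_smul' _ _ _ Int.cast_mul,
      Matrix.map_one _ Int.cast_zero Int.cast_one]
    push_cast
    rfl
  refine eigenspace_eq_span_singleton ?_ (LinearMap.proj (φ := fun _ ↦ k) t.lastNode) ?_
    fun x hx hlast ↦ ?_
  · rw [Matrix.toLin'_apply]
    funext i
    have hi := congrArg ((↑) : ℤ → k) (congrFun (t.principalMatrix_mulVec_eigenCoeff m hm) i)
    simpa [Matrix.mulVec, dotProduct] using hi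
  · exact intCast_ne_zero_of_natAbs_mem_smoothNumbers ℓ hℓ
      (t.natAbs_eigenCoeff_lastNode_mem_smoothNumbers m hm)
  · refine eq_zero_of_mulVec_eq_zero_of_pivot
      (M := (t.principalMatrix - ((m : ℤ) * (m + 1)) • 1).map ((↑) : ℤ → k))
      t.pivotRow t.pivotRank (fun j hj ↦ ?_) (fun j hj j' hj' hle ↦ ?_) ?_ hlast
    · exact intCast_ne_zero_of_natAbs_mem_smoothNumbers ℓ hℓ
        (t.natAbs_pivot_mem_smoothNumbers m hm j hj)
    · rw [Matrix.map_apply, t.sub_smul_one_pivotRow_eq_zero m hm j hj j' hj' hle, Int.cast_zero]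
    · rw [← hshift, Matrix.sub_mulVec, Matrix.smul_mulVec, Matrix.one_mulVec, sub_eq_zero]
      exact hx

theorem hasExponents_principalMatrix :
    HasExponents (Matrix.toLin' (t.principalMatrix.map ((↑) : ℤ → k))) t.exponents
      fun m i ↦ (t.eigenCoeff m i : k) where
  finrank_eq := by rw [finrank_fin_fun, t.rank_eq_card_exponents]
  pos := t.pos_of_mem_exponents
  aeval_casimirPoly := by
    have hmap : (casimirPoly ℤ t.exponents).map (Int.castRingHom k) =
        casimirPoly k t.exponents := by
      simp [casimirPoly, Polynomial.map_prod]
    have hlast (m) (hm : m ∈ t.exponents) : t.eigenCoeff m ≠ 0 := fun h0 ↦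
      Nat.ne_zero_of_mem_smoothNumbers (t.natAbs_eigenCoeff_lastNode_mem_smoothNumbers m hm)
        (by rw [h0]; rfl)
    rw [← hmap, aeval_toLin'_map_intCast, aeval_casimirPoly_eq_zero t.rank_eq_card_exponents hlast
      t.principalMatrix_mulVec_eigenCoeff]
    simp
  eigenspace_eq _ hm := eigenspace_principalMatrix_eq_span (k := k) hℓ hm
  casimir_ne m hm a ha haE := by
    have hne := intCast_ne_zero_of_natAbs_mem_smoothNumbers (k := k) ℓ hℓ
      (t.natAbs_casimir_sub_mem_smoothNumbers m hm a ha haE)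
    rw [← sub_ne_zero]
    exact_mod_cast hne

variable {g : Type*} [LieRing g] [LieAlgebra k g] {B : ChevalleyBasis t.cartan k g}
  {φ : LieAlgebra.SpecialLinear.sl (Fin 2) k →ₗ⁅k⁆ g} (hφ : B.IsPrincipal φ)

include hφ

theorem twoRhoCheck_cartan_eq (i : Fin t.rank) :
    (twoRhoCheck t.cartan i : k) = t.twoRhoCoeff i := by
  have hdet : (t.cartan.map ((↑) : ℤ → k)).det ≠ 0 := by
    have hne := intCast_ne_zero_of_natAbs_mem_smoothNumbers (k := k) ℓ hℓ
      t.natAbs_det_cartan_mem_smoothNumbers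
    rwa [Int.cast_det] at hne
  have hsum (i : Fin t.rank) : ∑ j, (t.cartan i j * t.twoRhoCoeff j : k) = 2 := by
    have hi := congrArg ((↑) : ℤ → k) (congrFun t.cartan_mulVec_twoRhoCoeff i)
    simpa [Matrix.mulVec, dotProduct] using hi
  refine sub_eq_zero.mp (congrFun (Matrix.eq_zero_of_mulVec_eq_zero hdet
    (v := fun j ↦ (twoRhoCheck t.cartan j : k) - t.twoRhoCoeff j) ?_) i)
  funext i
  simp only [Matrix.mulVec, dotProduct, Matrix.map_apply, mul_sub, Finset.sum_sub_distrib, hsum,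
    ChevalleyBasis.sum_mul_twoRhoCheck hφ (two_ne_zero_of_coxeterNumber_le hℓ), sub_self,
    Pi.zero_apply]

theorem isPrincipallyGraded :
    B.IsPrincipallyGraded φ t.exponents fun m i ↦ (t.eigenCoeff m i : k) := by
  refine ChevalleyBasis.isPrincipallyGraded hφ (two_ne_zero_of_coxeterNumber_le hℓ)
    (natCast_injOn_Iic_exponent hℓ) t.hasExponentHeights ?_
  have hend : principalEnd t.cartan (fun i ↦ (twoRhoCheck t.cartan i : k)) =
      Matrix.toLin' (t.principalMatrix.map (↑)) := by
    refine congrArg Matrix.toLin' ?_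
    ext i j
    simp [principalMatrix, Matrix.diagonal_mul, twoRhoCheck_cartan_eq hℓ hφ]
  exact hend ▸ hasExponents_principalMatrix hℓ

end CharP

section IsMoved

theorem exists_isMoved_E₆ : ∃ i, IsMoved .E₆ i := by
  let σ : Equiv.Perm (Fin (rank .E₆)) := Equiv.swap 0 5 * Equiv.swap 2 4
  have hσ : (cartan .E₆).submatrix σ σ = cartan .E₆ := by
    decide +kernel
  exact ⟨0, σ, congrFun₂ hσ, by decide +kernel⟩

theorem perm_apply_eq_self_E₆ {σ : Equiv.Perm (Fin (rank .E₆))}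
    (hσ : ∀ a b, cartan .E₆ (σ a) (σ b) = cartan .E₆ a b) : σ 1 = 1 ∧ σ 3 = 3 := by
  have hrow (a) : ∑ b, cartan .E₆ (σ a) b = ∑ b, cartan .E₆ a b := by
    rw [← Equiv.sum_comp σ]
    exact Finset.sum_congr rfl fun b _ ↦ hσ a b
  have hbranch : ∀ j, ∑ b, cartan .E₆ j b = ∑ b, cartan .E₆ 3 b → j = 3 := by
    decide +kernel
  have hleaf : ∀ j, ∑ b, cartan .E₆ j b = ∑ b, cartan .E₆ 1 b →
      cartan .E₆ j 3 = cartan .E₆ 1 3 → j = 1 := by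
    decide +kernel
  have h3 : σ 3 = 3 := hbranch _ (hrow 3)
  exact ⟨hleaf _ (hrow 1) (by simpa only [h3] using hσ 1 3), h3⟩

theorem IsMoved.ne_one_and_ne_three {i : Fin (rank .E₆)} (hi : IsMoved .E₆ i) :
    i ≠ 1 ∧ i ≠ 3 := by
  obtain ⟨σ, hσ, hne⟩ := hi
  obtain ⟨h1, h3⟩ := perm_apply_eq_self_E₆ hσ
  exact ⟨fun h ↦ hne (h ▸ h1), fun h ↦ hne (h ▸ h3)⟩

end IsMoved

end ExceptionalType

theorem mainTheorem12 (t : ExceptionalType) {k g : Type*} [Field k] (ℓ : ℕ) [CharP k ℓ]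
    [LieRing g] [LieAlgebra k g] (B : ChevalleyBasis t.cartan k g)
    (φ : LieAlgebra.SpecialLinear.sl (Fin 2) k →ₗ⁅k⁆ g) (hφ : B.IsPrincipal φ) :
    -- For `ℓ = 0` or `ℓ ≥ 2h - 1`, `V_m` is the unique `sl₂`-submodule isomorphic to `Sym^{2m}(k²)`,
    -- and it is a direct summand.
    ((ℓ = 0 ∨ 2 * t.coxeterNumber - 1 ≤ ℓ) → ∀ m ∈ t.exponents,
      IsSymPower φ (2 * m) (B.summand φ m) ∧
      (∀ W : Submodule k g, IsSymPower φ (2 * m) W → W = B.summand φ m) ∧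
      ∃ W : Submodule k g, IsSl2Stable φ W ∧ IsCompl (B.summand φ m) W) ∧
    -- For `ℓ = 0` or `ℓ ≥ h`, `P_{2m}` is a line, and `V_m` contains a unique line in the sum of the
    -- negative simple root spaces.
    ((ℓ = 0 ∨ t.coxeterNumber ≤ ℓ) → ∀ m ∈ t.exponents,
      Module.finrank k (B.centralizerEigenspace m) = 1 ∧
      Module.finrank k ↥(B.summand φ m ⊓ B.negSimpleSpace) = 1) ∧
    -- Types `G₂, F₄, E₇, E₈`, primes that are not listed.
    (t ≠ .E₆ → ℓ ∉ t.badPrimes → ∀ m ∈ t.exponents, ∀ i,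
      B.ProjNegRootNonzero (B.summand φ m ⊓ B.negSimpleSpace) i) ∧
    -- Listed primes `ℓ ≥ h` are exceptions.
    (ℓ ∈ t.badPrimes → t.coxeterNumber ≤ ℓ → ∃ m ∈ t.exponents, ∃ i,
      ¬ B.ProjNegRootNonzero (B.summand φ m ⊓ B.negSimpleSpace) i) ∧
    -- Type `E₆`.
    (t = .E₆ → ℓ ∉ t.badPrimes →
      (∀ m ∈ t.exponents, m ≠ 4 → m ≠ 8 → ∀ i,
        B.ProjNegRootNonzero (B.summand φ m ⊓ B.negSimpleSpace) i) ∧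
      (∃ i, t.IsMoved i) ∧
      ∀ i, t.IsMoved i →
        (∀ m ∈ ({4, 8} : Finset ℕ),
          B.ProjNegRootNonzero (B.summand φ m ⊓ B.negSimpleSpace) i) ∧
        ∀ m ∈ t.exponents,
          B.ProjCorootNonzero (B.summand φ m ⊓ B.cartanSpace) i) := by
  have := B.finiteDimensional t.hasExponentHeights
  have hG (hℓ : ℓ = 0 ∨ t.coxeterNumber ≤ ℓ) := ExceptionalType.isPrincipallyGraded hℓ hφ
  have hG' (hℓ : ℓ ∉ t.badPrimes) := hG (t.coxeterNumber_le_of_notMem_badPrimes (k := k) ℓ hℓ)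
  refine ⟨fun hℓ m hm ↦ ?_, fun hℓ m hm ↦ ?_, fun ht hℓ m hm i ↦ ?_, fun hℓ hhℓ ↦ ?_, ?_⟩
  · have hG := hG (hℓ.imp_right (by have := t.two_lt_coxeterNumber; omega))
    have hfac := t.factorial_two_mul_ne_zero (k := k) ℓ hℓ hm
    exact ⟨hG.isSymPower_summand hm hfac, fun W ↦ hG.eq_summand_of_isSymPower hm hfac,
      hG.exists_isCompl_summand (t.injOn_mul_add_one_exponents ℓ hℓ) hm⟩
  · exact ⟨(hG hℓ).finrank_centralizerEigenspace hm,
      (hG hℓ).finrank_summand_inf_negSimpleSpace hm⟩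
  · exact ((hG' hℓ).projNegRootNonzero_iff hm i).mpr
      (t.intCast_eigenCoeff_ne_zero ℓ hℓ hm (t.eigenCoeff_ne_zero ht m hm i))
  · obtain ⟨m, hm, i, hdvd⟩ := t.exists_dvd_eigenCoeff ℓ hℓ hhℓ
    exact ⟨m, hm, i, fun h ↦ ((hG (.inr hhℓ)).projNegRootNonzero_iff hm i).mp h
      ((CharP.intCast_eq_zero_iff k ℓ _).mpr hdvd)⟩
  · rintro rfl hℓ
    have hu (m) (hm : m ∈ ExceptionalType.exponents .E₆) (i) (hi) :=
      ExceptionalType.intCast_eigenCoeff_ne_zero (k := k) .E₆ ℓ hℓ hm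
        (ExceptionalType.eigenCoeff_E₆_ne_zero m hm i hi)
    have hneg (m) (hm) (i) (hi) := ((hG' hℓ).projNegRootNonzero_iff hm i).mpr (hu m hm i hi)
    refine ⟨fun m hm h4 h8 i ↦ hneg m hm i (.inl ⟨h4, h8⟩), ExceptionalType.exists_isMoved_E₆,
      fun i hi ↦ ⟨fun m hm ↦ hneg m ?_ i (.inr hi.ne_one_and_ne_three), fun m hm ↦ ?_⟩⟩
    · revert m
      decide
    · exact (hG' hℓ).projCorootNonzero hm (ExceptionalType.cartan_diag _ i)
        (hu m hm i (.inr hi.ne_one_and_ne_three))
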